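/- Let $R$ be a commutative ring with unit and let $I\subseteq R$ be an ideal generated by a finite regular sequence $r_1,\dots,r_m$, i.e. each $r_i$ is a non-zero-divisor on $R/(r_1,\dots,r_{i-1})$ (the degenerate cases $m=0$ and $I=R$ are allowed). Fix $s\ge 0$, with the convention $I^0=R$. Let $$p_*\colon \operatorname{Tor}_n^R(R/I, I^s)\to \operatorname{Tor}_n^R(R/I, I^s/I^{s+1})$$ be the map induced by the projection $I^s\to I^s/I^{s+1}$, and let $$\delta\colon \operatorname{Tor}_{n}^R(R/I, I^s/I^{s+1})\to \operatorname{Tor}_{n-1}^R(R/I, I^{s+1})$$ be the connecting homomorphism associated with the short exact sequence $0\to I^{s+1}\to I^s\to I^s/I^{s+1}\to 0$. Then for every $n\ge 0$ the sequence of $R/I$-modules $$0 \to \operatorname{Tor}_n^R(R/I, I^s) \xrightarrow{\ p_*\ } \operatorname{Tor}_n^R(R/I, I^s/I^{s+1}) \xrightarrow{\ \delta\ } \operatorname{Tor}_{n-1}^R(R/I, I^{s+1}) \to 0$$ is exact, where $\operatorname{Tor}_{-1}^R=0$ (so for $n=0$ the map $p_*$ is an isomorphism). Moreover, for every $n\ge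 0$, the $R/I$-modules $\operatorname{Tor}_n^R(R/I, I^s)$, $\operatorname{Tor}_n^R(R/I, I^s/I^{s+1})$ and $\operatorname{Tor}_n^R(R/I, I^{s+1})$ are free. -/

import Mathlib

open CategoryTheory MonoidalCategory

universe u

noncomputable section

namespace RegularTor

section LongExact

variable {R : Type u} [CommRing R]

/-- `Tor_n^R(M, N)`: the `n`-th left derived functor of `- ⊗ N`, evaluated at `M`. -/
abbrev TorObj (n : ℕ) (M N : ModuleCat.{u} R) : ModuleCat.{u} R :=
  ((Tor' (ModuleCat.{u} R) n).obj M).obj N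

/-- The map `Tor_n^R(M, A) ⟶ Tor_n^R(M, B)` induced by `A ⟶ B`. -/
abbrev torObjMap (n : ℕ) (M : ModuleCat.{u} R) {A B : ModuleCat.{u} R} (f : A ⟶ B) :
    TorObj n M A ⟶ TorObj n M B :=
  ((Tor' (ModuleCat.{u} R) n).obj M).map f

/-- For a complex `P` and a short complex `A ⟶ B ⟶ C` of modules, the short complex of
complexes `P ⊗ A ⟶ P ⊗ B ⟶ P ⊗ C`. -/
def tensorShortComplex (P : ChainComplex (ModuleCat.{u} R) ℕ)
    (S : ShortComplex (ModuleCat.{u} R)) :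
    ShortComplex (ChainComplex (ModuleCat.{u} R) ℕ) where
  X₁ := (((tensoringRight (ModuleCat.{u} R)).obj S.X₁).mapHomologicalComplex _).obj P
  X₂ := (((tensoringRight (ModuleCat.{u} R)).obj S.X₂).mapHomologicalComplex _).obj P
  X₃ := (((tensoringRight (ModuleCat.{u} R)).obj S.X₃).mapHomologicalComplex _).obj P
  f := (NatTrans.mapHomologicalComplex ((tensoringRight (ModuleCat.{u} R)).map S.f) _).app P
  g := (NatTrans.mapHomologicalComplex ((tensoringRight (ModuleCat.{u} R)).map S.g) _).app P
  zero := by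
    ext i : 1
    change (P.X i ◁ S.f) ≫ (P.X i ◁ S.g) = 0
    rw [← MonoidalCategory.whiskerLeft_comp, S.zero, MonoidalPreadditive.whiskerLeft_zero]

theorem tensorShortComplex_shortExact {M : ModuleCat.{u} R} (P : ProjectiveResolution M)
    {S : ShortComplex (ModuleCat.{u} R)} (hS : S.ShortExact) :
    (tensorShortComplex P.complex S).ShortExact := by
  refine HomologicalComplex.shortExact_of_degreewise_shortExact _ fun i => ?_
  have hp : Module.Projective R (P.complex.X i) :=
    (IsProjective.iff_projective (P.complex.X i)).2 (P.projective i)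
  have hex := (ShortComplex.ShortExact.moduleCat_exact_iff_function_exact S).1 hS.exact
  refine ModuleCat.shortComplex_shortExact _ ?_ ?_ ?_
  · exact Module.Flat.lTensor_exact (P.complex.X i) hex
  · exact Module.Flat.lTensor_preserves_injective_linearMap (M := P.complex.X i) S.f.hom
      hS.moduleCat_injective_f
  · exact LinearMap.lTensor_surjective (P.complex.X i) hS.moduleCat_surjective_g

/-- The connecting homomorphism `Tor_{n+1}^R(M, C) ⟶ Tor_n^R(M, A)` of a short exact sequence
`0 ⟶ A ⟶ B ⟶ C ⟶ 0`, i.e. the connecting homomorphism in the homology of the short exact sequence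
of complexes `0 ⟶ P ⊗ A ⟶ P ⊗ B ⟶ P ⊗ C ⟶ 0`, for a projective resolution `P` of `M`. -/
def torObjδ (n : ℕ) (M : ModuleCat.{u} R) {S : ShortComplex (ModuleCat.{u} R)}
    (hS : S.ShortExact) : TorObj (n + 1) M S.X₃ ⟶ TorObj n M S.X₁ :=
  ((projectiveResolution M).isoLeftDerivedObj
      ((tensoringRight (ModuleCat.{u} R)).obj S.X₃) (n + 1)).hom ≫
    (tensorShortComplex_shortExact (projectiveResolution M) hS).δ (n + 1) n (by simp) ≫
    ((projectiveResolution M).isoLeftDerivedObj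
      ((tensoringRight (ModuleCat.{u} R)).obj S.X₁) n).inv

end LongExact

section Quotient

variable {R : Type u} [CommRing R] (I : Ideal R)

/-- The underlying type of `Tor_n^R(R/I, N)`. -/
abbrev TorQuot (n : ℕ) (N : ModuleCat.{u} R) : Type u :=
  TorObj n (ModuleCat.of R (R ⧸ I)) N

theorem torQuot_isTorsionBySet (n : ℕ) (N : ModuleCat.{u} R) :
    Module.IsTorsionBySet R (TorQuot I n N) I := by
  rintro x ⟨r, hr⟩
  let M : ModuleCat.{u} R := ModuleCat.of R (R ⧸ I)
  let P := projectiveResolution M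
  let F := (tensoringRight (ModuleCat.{u} R)).obj N
  have h0 : r • 𝟙 M = 0 := by
    refine ModuleCat.hom_ext (LinearMap.ext fun (y : R ⧸ I) => ?_)
    obtain ⟨y, rfl⟩ := Ideal.Quotient.mk_surjective y
    change r • (Ideal.Quotient.mk I y) = 0
    rw [← Ideal.Quotient.mk_eq_mk, ← Submodule.Quotient.mk_smul]
    exact (Submodule.Quotient.mk_eq_zero _).2 (I.mul_mem_right y hr)
  have h0' (A : ModuleCat.{u} R) (f : A ⟶ M) : r • f = 0 := by
    rw [← Category.comp_id f, ← Linear.comp_smul, h0, Limits.comp_zero]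
  have hw : (r • 𝟙 P.complex) ≫ P.π = P.π ≫ (ChainComplex.single₀ _).map (0 : M ⟶ M) := by
    rw [Functor.map_zero, Limits.comp_zero, Linear.smul_comp, Category.id_comp]
    refine HomologicalComplex.hom_ext _ _ fun i => ?_
    cases i with
    | zero => exact h0' _ (P.π.f 0)
    | succ i => exact (HomologicalComplex.isZero_single_obj_X _ _ _ _ (by simp)).eq_of_tgt _ _
  have hs : (F.mapHomologicalComplex _ ⋙ HomologicalComplex.homologyFunctor _ _ n).map
      (r • 𝟙 P.complex) = r • 𝟙 ((HomologicalComplex.homologyFunctor _ _ n).obj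
        ((F.mapHomologicalComplex _).obj P.complex)) := by
    rw [← CategoryTheory.Functor.map_id, Functor.comp_map, Functor.map_smul,
      CategoryTheory.Functor.map_id]
    exact ShortComplex.homologyMap_smul ((HomologicalComplex.shortComplexFunctor _ _ n).map
      (𝟙 ((F.mapHomologicalComplex _).obj P.complex))) r
  have h1 := Functor.leftDerived_map_eq F n (0 : M ⟶ M) (r • 𝟙 P.complex) hw
  have h2 : r • 𝟙 ((F.leftDerived n).obj M) = 0 := by
    have h3 : (F.leftDerived n).map (0 : M ⟶ M) = 0 := by
      rw [Functor.leftDerived_map_eq F n (0 : M ⟶ M) (0 : P.complex ⟶ P.complex) (by simp),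
        Functor.map_zero, Limits.zero_comp, Limits.comp_zero]
    rw [← h3, h1, hs, Linear.smul_comp, Linear.comp_smul, Category.id_comp, Iso.hom_inv_id]
  exact congrArg (fun φ => φ.hom x) h2

/-- The `R/I`-module structure on `Tor_n^R(R/I, N)`: the class of `r` acts as `r`. -/
instance torQuotModule (n : ℕ) (N : ModuleCat.{u} R) : Module (R ⧸ I) (TorQuot I n N) :=
  (torQuot_isTorsionBySet I n N).module

instance torQuotIsScalarTower (n : ℕ) (N : ModuleCat.{u} R) :
    IsScalarTower R (R ⧸ I) (TorQuot I n N) :=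
  (torQuot_isTorsionBySet I n N).isScalarTower

/-- The `R/I`-linear map `Tor_n^R(R/I, A) → Tor_n^R(R/I, B)` induced by `A ⟶ B`. -/
def torMap (n : ℕ) {A B : ModuleCat.{u} R} (f : A ⟶ B) :
    TorQuot I n A →ₗ[R ⧸ I] TorQuot I n B :=
  (torObjMap n (ModuleCat.of R (R ⧸ I)) f).hom.extendScalarsOfSurjective
    Ideal.Quotient.mk_surjective

/-- The connecting homomorphism `Tor_{n+1}^R(R/I, C) → Tor_n^R(R/I, A)` of a short exact sequence
`0 ⟶ A ⟶ B ⟶ C ⟶ 0` of `R`-modules, as an `R/I`-linear map. -/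
def torδ (n : ℕ) {S : ShortComplex (ModuleCat.{u} R)} (hS : S.ShortExact) :
    TorQuot I (n + 1) S.X₃ →ₗ[R ⧸ I] TorQuot I n S.X₁ :=
  (torObjδ n (ModuleCat.of R (R ⧸ I)) hS).hom.extendScalarsOfSurjective
    Ideal.Quotient.mk_surjective

end Quotient

section Powers

variable {R : Type u} [CommRing R] (I : Ideal R)

/-- The sequence `I^(s+1) ⟶ I^s ⟶ I^s/I^(s+1)` of `R`-modules, where `I^0 = R`. -/
def powShortComplex (s : ℕ) : ShortComplex (ModuleCat.{u} R) where
  X₁ := ModuleCat.of R ↥(I ^ (s + 1))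
  X₂ := ModuleCat.of R ↥(I ^ s)
  X₃ := ModuleCat.of R (↥(I ^ s) ⧸ Submodule.submoduleOf (I ^ (s + 1)) (I ^ s))
  f := ModuleCat.ofHom (Submodule.inclusion (Ideal.pow_le_pow_right (Nat.le_succ s)))
  g := ModuleCat.ofHom (Submodule.mkQ (Submodule.submoduleOf (I ^ (s + 1)) (I ^ s)))
  zero := by
    ext x
    exact (Submodule.Quotient.mk_eq_zero _).2 x.2

theorem powShortComplex_shortExact (s : ℕ) : (powShortComplex I s).ShortExact := by
  refine ModuleCat.shortComplex_shortExact _ ?_ ?_ ?_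
  · intro y
    constructor
    · intro hy
      exact ⟨⟨y.1, (Submodule.Quotient.mk_eq_zero
        (Submodule.submoduleOf (I ^ (s + 1)) (I ^ s)) (x := y)).1 hy⟩, rfl⟩
    · rintro ⟨x, rfl⟩
      exact (Submodule.Quotient.mk_eq_zero _).2 x.2
  · exact Submodule.inclusion_injective (Ideal.pow_le_pow_right (Nat.le_succ s))
  · exact Submodule.mkQ_surjective _

end Powers

end RegularTor

end

/-! The carrier of the proof is `IsRegularFamily.exists_koszulD_eq`: a Koszul cycle with
coefficients in I^(s+1) is the boundary of a chain with coefficients in I^s. As the Koszul complex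
of r resolves R/I, this makes Tor_n(R/I, I^(s+1)) → Tor_n(R/I, I^s) zero for every n, and the long
exact sequence of Tor breaks into the short ones.

To control powers of I, elements of I^t are written as values at r of homogeneous polynomials of
degree t. Over R[X] the Koszul complex of the variables has a homotopy h that merely moves
coefficients and divides by no integer (`koszulD_koszulHomotopy_add`). Replacing a lift G by F = hdG
keeps the boundary and gives F = hdF. If that boundary, evaluated at r, lies one power of I deeper
than its degree predicts, quasi-regularity puts the coefficients of dF, hence those of F, into I. So
a primitive can be improved one power at a time. Quasi-regularity follows from regularity by strong
induction on the degree, using the improvement of primitives in lower degrees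
(`IsRegularFamily.isQuasiRegularIn`).

For freeness, the chains with F = hdF have an explicit monomial basis, the leading pairs
(`exists_monomialChain_eq`). The boundaries of their values exhaust the cycles over I^(t+1), and
such a boundary already bounds over I^(t+1) exactly when all the coefficients lie in I. Hence
leading pairs index an R/I-basis of Tor_n(R/I, I^(t+1)); the power I^0 is treated directly. Finally
Tor_n(R/I, I^s/I^(s+1)) is an extension of a free module by a free module. -/

/-! ### The Koszul differential on exterior monomials. -/

section Koszul

variable {σ : Type*} [LinearOrder σ] {R : Type*} [CommRing R]

/-- The sign with which `j` is contracted out of the exterior monomial indexed by `insert j S`. -/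
def koszulSign (R : Type*) [CommRing R] (j : σ) (S : Finset σ) : R :=
  (-1) ^ (S.filter (· < j)).card

theorem koszulSign_insert_of_lt {j k : σ} {S : Finset σ} (hjk : j < k) (hj : j ∉ S) :
    koszulSign R k (insert j S) = -koszulSign R k S := by
  rw [koszulSign, koszulSign, Finset.filter_insert, if_pos hjk, Finset.card_insert_of_notMem
    (fun h => hj (Finset.mem_of_mem_filter _ h)), pow_succ, mul_neg_one]

theorem koszulSign_insert_of_le {j k : σ} {S : Finset σ} (hjk : k ≤ j) :
    koszulSign R k (insert j S) = koszulSign R k S := by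
  rw [koszulSign, koszulSign, Finset.filter_insert, if_neg (not_lt.2 hjk)]

theorem koszulSign_of_forall_le {j : σ} {S : Finset σ} (h : ∀ x ∈ S, j ≤ x) :
    koszulSign R j S = 1 := by
  rw [koszulSign, Finset.filter_false_of_mem (fun x hx => not_lt.2 (h x hx)), Finset.card_empty,
    pow_zero]

theorem koszulSign_of_forall_lt {j : σ} {S : Finset σ} (h : ∀ x ∈ S, x < j) :
    koszulSign R j S = (-1) ^ S.card := by
  rw [koszulSign, Finset.filter_true_of_mem h]

theorem map_koszulSign {R' : Type*} [CommRing R'] (φ : R →+* R') (j : σ) (S : Finset σ) :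
    φ (koszulSign R j S) = koszulSign R' j S := by
  simp [koszulSign]

variable {M : Type*} [AddCommGroup M] [Module R M]

section Support

omit [LinearOrder σ]

/-- `f` is supported on the exterior monomials of degree `n` in the variables of `T`. -/
def KoszulSupported (T : Finset σ) (n : ℕ) (f : Finset σ → M) : Prop :=
  ∀ S, f S ≠ 0 → S.card = n ∧ S ⊆ T

theorem KoszulSupported.add {T : Finset σ} {n : ℕ} {f g : Finset σ → M}
    (hf : KoszulSupported T n f) (hg : KoszulSupported T n g) : KoszulSupported T n (f + g) := by
  intro S hS
  by_cases h : f S = 0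
  · exact hg S fun h' => hS (by simp [h, h'])
  · exact hf S h

theorem KoszulSupported.smul {T : Finset σ} {n : ℕ} {f : Finset σ → M}
    (hf : KoszulSupported T n f) (c : R) : KoszulSupported T n (c • f) := fun S hS =>
  hf S fun h' => hS (by simp [h'])

theorem KoszulSupported.eq_zero {T : Finset σ} {n : ℕ} {f : Finset σ → M}
    (hf : KoszulSupported T n f) {S : Finset σ} (hS : S.card = n → ¬ S ⊆ T) : f S = 0 := by
  by_contra h
  exact hS (hf S h).1 (hf S h).2

end Support

section Split

variable (a : σ)

/-- The part of `f` not involving `a`. -/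
def koszulAvoid (f : Finset σ → M) (S : Finset σ) : M := if a ∈ S then 0 else f S

/-- The cofactor of `a` in `f`. -/
def koszulCofactor (f : Finset σ → M) (S : Finset σ) : M := if a ∈ S then 0 else f (insert a S)

variable {a}

theorem koszul_ext {f g : Finset σ → M} (h₁ : koszulAvoid a f = koszulAvoid a g)
    (h₂ : koszulCofactor a f = koszulCofactor a g) : f = g := by
  ext S
  by_cases ha : a ∈ S
  · have := congrFun h₂ (S.erase a)
    simpa [koszulCofactor, Finset.insert_erase ha] using this
  · have := congrFun h₁ S
    simpa [koszulAvoid, ha] using this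

variable {T : Finset σ} {n : ℕ} {f : Finset σ → M}

theorem KoszulSupported.avoid (hf : KoszulSupported (insert a T) n f) :
    KoszulSupported T n (koszulAvoid a f) := by
  intro S hS
  by_cases ha : a ∈ S
  · exact absurd (if_pos ha) hS
  · rw [koszulAvoid, if_neg ha] at hS
    exact ⟨(hf S hS).1, (Finset.subset_insert_iff_of_notMem ha).1 (hf S hS).2⟩

theorem KoszulSupported.cofactor (hf : KoszulSupported (insert a T) (n + 1) f) :
    KoszulSupported T n (koszulCofactor a f) := by
  intro S hS
  by_cases ha : a ∈ S
  · exact absurd (if_pos ha) hS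
  · rw [koszulCofactor, if_neg ha] at hS
    obtain ⟨h1, h2⟩ := hf _ hS
    rw [Finset.card_insert_of_notMem ha] at h1
    exact ⟨by omega, (Finset.subset_insert_iff_of_notMem ha).1
      ((Finset.subset_insert a S).trans h2)⟩

end Split

variable [Fintype σ]

/-- The Koszul differential of the family `r` on the exterior algebra with coefficients in `M`,
whose elements are written as functions on the set of exterior monomials. -/
def koszulD (r : σ → R) : (Finset σ → M) →ₗ[R] (Finset σ → M) where
  toFun f S := ∑ j ∈ Sᶜ, (koszulSign R j S * r j) • f (insert j S)
  map_add' f g := by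
    ext S
    simp [Finset.sum_add_distrib]
  map_smul' c f := by
    ext S
    simp only [Pi.smul_apply, Finset.smul_sum, RingHom.id_apply]
    exact Finset.sum_congr rfl fun j _ => smul_comm _ _ _

theorem koszulD_apply (r : σ → R) (f : Finset σ → M) (S : Finset σ) :
    koszulD r f S = ∑ j ∈ Sᶜ, (koszulSign R j S * r j) • f (insert j S) :=
  rfl

theorem koszulD_koszulD (r : σ → R) (f : Finset σ → M) : koszulD r (koszulD r f) = 0 := by
  ext S
  simp only [koszulD_apply, Finset.smul_sum, Pi.zero_apply]
  rw [Finset.sum_sigma']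
  have key : ∀ j k : σ, j < k → j ∉ S → k ∉ S →
      ((koszulSign R j S * r j) • (koszulSign R k (insert j S) * r k) •
          f (insert k (insert j S))) +
        ((koszulSign R k S * r k) • (koszulSign R j (insert k S) * r j) •
          f (insert j (insert k S))) = 0 := by
    intro j k hjk hj hk
    rw [koszulSign_insert_of_lt hjk hj, koszulSign_insert_of_le hjk.le, Finset.insert_comm k j,
      smul_smul, smul_smul, ← add_smul]
    convert zero_smul R _
    ring
  have hmem : ∀ a : (_ : σ) × σ, a ∈ Sᶜ.sigma (fun j => (insert j S)ᶜ) →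
      a.1 ∉ S ∧ a.2 ∉ S ∧ a.2 ≠ a.1 := by
    intro a ha
    simp only [Finset.mem_sigma, Finset.mem_compl, Finset.mem_insert, not_or] at ha
    exact ⟨ha.1, ha.2.2, ha.2.1⟩
  -- Contracting j and k in the two possible orders gives opposite signs, so swapping the pair
  -- cancels the double sum.
  refine Finset.sum_involution (fun a _ => ⟨a.2, a.1⟩) ?_ ?_ ?_ ?_
  · intro a ha
    obtain ⟨h1, h2, h3⟩ := hmem a ha
    rcases lt_or_gt_of_ne h3 with h | h
    · rw [add_comm]
      exact key _ _ h h2 h1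
    · exact key _ _ h h1 h2
  · intro a ha _ h
    exact (hmem a ha).2.2 (congrArg Sigma.fst h)
  · intro a ha
    obtain ⟨h1, h2, h3⟩ := hmem a ha
    simp only [Finset.mem_sigma, Finset.mem_compl, Finset.mem_insert, not_or]
    exact ⟨h2, h3.symm, h1⟩
  · intro a ha
    rfl

theorem KoszulSupported.koszulD {T : Finset σ} {n : ℕ} {f : Finset σ → M}
    (hf : KoszulSupported T (n + 1) f) (r : σ → R) : KoszulSupported T n (koszulD r f) := by
  intro S hS
  obtain ⟨j, hj, hjS⟩ := Finset.exists_ne_zero_of_sum_ne_zero hS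
  obtain ⟨h1, h2⟩ := hf (insert j S) fun h => hjS (by rw [h, smul_zero])
  rw [Finset.card_insert_of_notMem (Finset.mem_compl.1 hj)] at h1
  exact ⟨by omega, (Finset.subset_insert j S).trans h2⟩

/-- With `koszulD_empty_mem`, this identifies the boundaries in degree 0 with the ideal generated by
the variables' values on T. -/
theorem exists_koszulD_eq_single_empty (r : σ → R) (T : Finset σ) {x : R}
    (hx : x ∈ Ideal.span (r '' T)) :
    ∃ g : Finset σ → R, KoszulSupported T 1 g ∧ koszulD r g = Pi.single ∅ x := by
  induction hx using Submodule.span_induction with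
  | mem x hx =>
    obtain ⟨j, hj, rfl⟩ := hx
    have hsupp : KoszulSupported T 1 (Pi.single {j} (1 : R) : Finset σ → R) := by
      intro S hS
      have : S = {j} := by
        by_contra h
        exact hS (by simp [h])
      subst this
      exact ⟨Finset.card_singleton j, Finset.singleton_subset_iff.2 hj⟩
    refine ⟨Pi.single {j} 1, hsupp, ?_⟩
    ext S
    by_cases hS : S = ∅
    · subst hS
      rw [koszulD_apply, Finset.sum_eq_single j]
      · simp [koszulSign]
      · intro k _ hk
        simp [hk]
      · simp
    · rw [(hsupp.koszulD r).eq_zero fun h => absurd (Finset.card_eq_zero.1 h) hS]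
      simp [hS]
  | zero => exact ⟨0, fun S hS => absurd rfl hS, by simp⟩
  | add x y _ _ hx hy =>
    obtain ⟨f, hf, hf'⟩ := hx
    obtain ⟨g, hg, hg'⟩ := hy
    exact ⟨f + g, hf.add hg, by rw [map_add, hf', hg', Pi.single_add]⟩
  | smul c x _ hx =>
    obtain ⟨f, hf, hf'⟩ := hx
    exact ⟨c • f, hf.smul c, by rw [map_smul, hf', Pi.single_smul]⟩

theorem koszulD_empty_mem (r : σ → R) {T : Finset σ} {n : ℕ} {f : Finset σ → R}
    (hf : KoszulSupported T n f) : koszulD r f ∅ ∈ Ideal.span (r '' T) := by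
  rw [koszulD_apply]
  refine Submodule.sum_mem _ fun j _ => ?_
  by_cases h : f (insert j ∅) = 0
  · rw [h, smul_zero]
    exact zero_mem _
  · have hj : j ∈ T := (hf _ h).2 (Finset.mem_insert_self j ∅)
    rw [smul_eq_mul, mul_right_comm]
    exact Ideal.mul_mem_left _ _ (Ideal.subset_span ⟨j, hj, rfl⟩)

section Split

variable {a : σ} {T : Finset σ} {n : ℕ} {f : Finset σ → M}

/-- As a is the largest variable, adjoining it changes no sign in the contraction of the others.
With `koszulAvoid_koszulD`, this presents the complex on `insert a T` as the mapping cone of ± r a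
on the complex of T. -/
theorem koszulCofactor_koszulD (r : σ → R) (hT : ∀ x ∈ T, x < a)
    (hf : KoszulSupported (insert a T) n f) :
    koszulCofactor a (koszulD r f) = koszulD r (koszulCofactor a f) := by
  ext S
  by_cases ha : a ∈ S
  · rw [koszulCofactor, if_pos ha, koszulD_apply, Finset.sum_eq_zero]
    intro j _
    rw [koszulCofactor, if_pos (Finset.mem_insert_of_mem ha), smul_zero]
  · rw [koszulCofactor, if_neg ha, koszulD_apply, koszulD_apply]
    have hc : (Sᶜ : Finset σ) = insert a (insert a S)ᶜ := by
      ext x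
      simp only [Finset.mem_compl, Finset.mem_insert]
      by_cases hx : x = a
      · simp [hx, ha]
      · simp [hx]
    rw [hc, Finset.sum_insert (by simp), koszulCofactor, if_pos (Finset.mem_insert_self a S),
      smul_zero, zero_add]
    refine Finset.sum_congr rfl fun j hj => ?_
    simp only [Finset.mem_compl, Finset.mem_insert, not_or] at hj
    rw [koszulCofactor, if_neg (by simp [ha, Ne.symm hj.1]), Finset.insert_comm a j]
    by_cases h : f (insert j (insert a S)) = 0
    · rw [h, smul_zero, smul_zero]
    · have h2 := (hf _ h).2 (Finset.mem_insert_self j _)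
      rw [koszulSign_insert_of_le (hT j ((Finset.mem_insert.1 h2).resolve_left hj.1)).le]

/-- The extra term comes from contracting a itself; its sign is (-1)^n because all n elements of S
precede a. -/
theorem koszulAvoid_koszulD (r : σ → R) (hT : ∀ x ∈ T, x < a)
    (hf : KoszulSupported (insert a T) (n + 1) f) :
    koszulAvoid a (koszulD r f) =
      koszulD r (koszulAvoid a f) + ((-1) ^ n * r a) • koszulCofactor a f := by
  ext S
  rw [Pi.add_apply, Pi.smul_apply]
  by_cases ha : a ∈ S
  · rw [koszulAvoid, if_pos ha, koszulCofactor, if_pos ha, smul_zero, add_zero, koszulD_apply,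
      Finset.sum_eq_zero]
    intro j _
    rw [koszulAvoid, if_pos (Finset.mem_insert_of_mem ha), smul_zero]
  · rw [koszulAvoid, if_neg ha, koszulD_apply, koszulD_apply]
    have ha' : a ∈ (Sᶜ : Finset σ) := Finset.mem_compl.2 ha
    rw [← Finset.add_sum_erase _ _ ha', ← Finset.add_sum_erase (Sᶜ : Finset σ)
      (fun j => (koszulSign R j S * r j) • koszulAvoid a f (insert j S)) ha', koszulAvoid,
      if_pos (Finset.mem_insert_self a S), smul_zero, zero_add, add_comm]
    congr 1
    · refine Finset.sum_congr rfl fun j hj => ?_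
      rw [koszulAvoid, if_neg]
      simp [ha, Ne.symm (Finset.ne_of_mem_erase hj)]
    · rw [koszulCofactor, if_neg ha]
      by_cases h : f (insert a S) = 0
      · rw [h, smul_zero, smul_zero]
      · obtain ⟨h1, h2⟩ := hf _ h
        rw [Finset.card_insert_of_notMem ha] at h1
        have h3 : S ⊆ T := (Finset.subset_insert_iff_of_notMem ha).1
          ((Finset.subset_insert a S).trans h2)
        rw [koszulSign_of_forall_lt (fun x hx => hT x (h3 hx)), show S.card = n by omega]

end Split

/-! ### Acyclicity of the Koszul complex of a regular family. -/

/-- Each `r i` is a non-zero-divisor modulo the preceding ones. -/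
def IsRegularFamily (r : σ → R) : Prop :=
  ∀ i x, r i * x ∈ Ideal.span (r '' Set.Iio i) → x ∈ Ideal.span (r '' Set.Iio i)

/-- This is the mapping cone argument on elements, adjoining the variables in increasing order.
Lower sets are needed so that T is exactly the set of predecessors of the new variable a, where
regularity applies. -/
theorem IsRegularFamily.koszul_exact_of_isLowerSet {r : σ → R} (hr : IsRegularFamily r)
    (T : Finset σ) : IsLowerSet (T : Set σ) → ∀ n (f : Finset σ → R),
      KoszulSupported T (n + 1) f → koszulD r f = 0 →
      ∃ g, KoszulSupported T (n + 2) g ∧ koszulD r g = f := by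
  induction T using Finset.induction_on_max with
  | empty =>
    intro _ n f hf _
    refine ⟨0, fun S hS => absurd rfl hS, ?_⟩
    rw [map_zero]
    ext S
    refine (hf.eq_zero fun h h' => ?_).symm
    simp [Finset.subset_empty.1 h'] at h
  | insert a T hT ih =>
    intro hlow n f hf hdf
    have hTa : ∀ x, x ∈ T ↔ x < a := fun x => ⟨hT x, fun hx =>
      (Finset.mem_insert.1 (hlow hx.le (Finset.mem_insert_self a T))).resolve_left hx.ne⟩
    have hTI : (T : Set σ) = Set.Iio a := Set.ext hTa
    have ih := ih (hTI ▸ isLowerSet_Iio a)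
    have haT : a ∉ T := fun h => lt_irrefl a (hT a h)
    have h1 := koszulCofactor_koszulD r hT hf
    have h2 := koszulAvoid_koszulD r hT hf
    have h01 : koszulCofactor a (0 : Finset σ → R) = 0 := by ext; simp [koszulCofactor]
    have h02 : koszulAvoid a (0 : Finset σ → R) = 0 := by ext; simp [koszulAvoid]
    rw [hdf, h01] at h1
    rw [hdf, h02] at h2
    have hc : ∃ c, KoszulSupported T (n + 1) c ∧ koszulD r c = koszulCofactor a f := by
      cases n with
      | succ n => exact ih n _ hf.cofactor h1.symm
      | zero =>
        -- In degree 0 the cofactor is a scalar; df = 0 puts its product with r a in the ideal of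
        -- the earlier elements, and r a is a non-zero-divisor modulo that ideal.
        have h3 : koszulCofactor a f ∅ ∈ Ideal.span (r '' T) := by
          have h4 := congrFun h2 ∅
          have h5 := koszulD_empty_mem r hf.avoid
          rw [hTI] at h5 ⊢
          refine hr a _ ?_
          have h6 : r a * koszulCofactor a f ∅ = - koszulD r (koszulAvoid a f) ∅ := by
            simp only [Pi.zero_apply, Pi.add_apply, Pi.smul_apply, smul_eq_mul, pow_zero,
              one_mul] at h4
            linear_combination -h4
          rw [h6]
          exact neg_mem h5
        obtain ⟨g, hg, hg'⟩ := exists_koszulD_eq_single_empty r T h3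
        refine ⟨g, hg, hg'.trans ?_⟩
        ext S
        by_cases hS : S = ∅
        · subst hS
          simp
        · rw [Pi.single_eq_of_ne hS]
          exact (hf.cofactor.eq_zero fun h => absurd (Finset.card_eq_zero.1 h) hS).symm
    obtain ⟨c, hc, hc'⟩ := hc
    -- The primitive g sought has cofactor c, which contributes (-1)^(n+1) r a c to its boundary;
    -- the correction term compensates for this in advance.
    obtain ⟨e, he, he'⟩ := ih n (koszulAvoid a f + ((-1) ^ n * r a) • c)
      (hf.avoid.add (hc.smul _)) (by rw [map_add, map_smul, hc', ← h2])
    let g : Finset σ → R := fun S => if a ∈ S then c (S.erase a) else e S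
    have hg : KoszulSupported (insert a T) (n + 2) g := by
      intro S hS
      by_cases ha : a ∈ S
      · simp only [g, if_pos ha] at hS
        obtain ⟨h3, h4⟩ := hc _ hS
        rw [Finset.card_erase_of_mem ha] at h3
        exact ⟨by omega, Finset.subset_insert_iff.2 h4⟩
      · simp only [g, if_neg ha] at hS
        exact ⟨(he S hS).1, (he S hS).2.trans (Finset.subset_insert a T)⟩
    have hgc : koszulCofactor a g = c := by
      ext S
      by_cases ha : a ∈ S
      · rw [koszulCofactor, if_pos ha]
        exact (hc.eq_zero fun _ h => haT (h ha)).symm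
      · simp [koszulCofactor, ha, g]
    have hge : koszulAvoid a g = e := by
      ext S
      by_cases ha : a ∈ S
      · rw [koszulAvoid, if_pos ha]
        exact (he.eq_zero fun _ h => haT (h ha)).symm
      · simp [koszulAvoid, ha, g]
    refine ⟨g, hg, koszul_ext (a := a) ?_ ?_⟩
    · rw [koszulAvoid_koszulD r hT hg, hge, hgc, he', add_assoc, ← add_smul]
      convert add_zero _
      convert zero_smul R c
      ring
    · rw [koszulCofactor_koszulD r hT hg, hgc, hc']

/-- The Koszul complex of a regular family is a resolution. -/
theorem IsRegularFamily.koszul_exact {r : σ → R} (hr : IsRegularFamily r) {n : ℕ}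
    {f : Finset σ → R} (hf : KoszulSupported Finset.univ n f) (hdf : koszulD r f = 0)
    (h0 : f ∅ ∈ Ideal.span (Set.range r)) :
    ∃ g, KoszulSupported Finset.univ (n + 1) g ∧ koszulD r g = f := by
  cases n with
  | succ n => exact hr.koszul_exact_of_isLowerSet _ (by simpa using isLowerSet_univ) n f hf hdf
  | zero =>
    obtain ⟨g, hg, hg'⟩ := exists_koszulD_eq_single_empty r Finset.univ (by simpa using h0)
    refine ⟨g, hg, hg'.trans ?_⟩
    ext S
    by_cases hS : S = ∅
    · subst hS
      simp
    · rw [Pi.single_eq_of_ne hS]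
      exact (hf.eq_zero fun h => absurd (Finset.card_eq_zero.1 h) hS).symm

end Koszul

/-! ### The Koszul complex of the variables and its contracting homotopy. -/

section Polynomial

open MvPolynomial

variable {σ : Type*} [LinearOrder σ] {R : Type*} [CommRing R]

/-- The polynomial obtained by deleting from `p` all monomials involving a variable before `i`. -/
noncomputable def killBelow (i : σ) (p : MvPolynomial σ R) : MvPolynomial σ R :=
  open Classical in
  ∑ b ∈ p.support.filter (fun b => ∀ k < i, b k = 0), monomial b (coeff b p)

open Classical in
theorem coeff_killBelow (i : σ) (p : MvPolynomial σ R) (b : σ →₀ ℕ) :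
    coeff b (killBelow i p) = if ∀ k < i, b k = 0 then coeff b p else 0 := by
  rw [killBelow, coeff_sum]
  simp only [coeff_monomial]
  rw [Finset.sum_ite_eq']
  by_cases h : coeff b p = 0 <;> simp [h]

/-- Division by the variable `i` after the deletion of all monomials involving a variable
before `i`. -/
noncomputable def divFirst (i : σ) (p : MvPolynomial σ R) : MvPolynomial σ R :=
  (killBelow i p).divMonomial (Finsupp.single i 1)

open Classical in
theorem coeff_divFirst (i : σ) (p : MvPolynomial σ R) (b : σ →₀ ℕ) :
    coeff b (divFirst i p) =
      if ∀ k < i, b k = 0 then coeff (Finsupp.single i 1 + b) p else 0 := by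
  rw [divFirst, coeff_divMonomial, coeff_killBelow]
  congr 1
  refine propext (forall₂_congr fun k hk => ?_)
  simp [Finsupp.single_eq_of_ne hk.ne]

theorem divFirst_sum {ι : Type*} (i : σ) (s : Finset ι) (f : ι → MvPolynomial σ R) :
    divFirst i (∑ j ∈ s, f j) = ∑ j ∈ s, divFirst i (f j) := by
  ext b
  simp only [coeff_divFirst, coeff_sum]
  split_ifs <;> simp

theorem divFirst_C_mul (i : σ) (c : R) (p : MvPolynomial σ R) :
    divFirst i (C c * p) = C c * divFirst i p := by
  ext b
  simp only [coeff_divFirst, coeff_C_mul]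
  split_ifs <;> simp

@[simp]
theorem divFirst_zero (i : σ) : divFirst i (0 : MvPolynomial σ R) = 0 := by
  ext b
  simp [coeff_divFirst]

theorem divFirst_X_mul_of_lt {i j : σ} (hij : i < j) (p : MvPolynomial σ R) :
    divFirst i (X j * p) = X j * divFirst i p := by
  ext b
  simp only [coeff_divFirst, coeff_X_mul']
  have h1 : j ∈ (Finsupp.single i 1 + b).support ↔ j ∈ b.support := by
    simp [Finsupp.single_eq_of_ne hij.ne']
  by_cases hj : j ∈ b.support
  · rw [if_pos (h1.2 hj), if_pos hj]
    have h2 : (∀ k < i, (b - Finsupp.single j 1 : σ →₀ ℕ) k = 0) ↔ ∀ k < i, b k = 0 :=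
      forall₂_congr fun k hk => by simp [Finsupp.single_eq_of_ne (hk.trans hij).ne]
    have h3 : Finsupp.single i 1 + b - Finsupp.single j 1 =
        Finsupp.single i 1 + (b - Finsupp.single j 1) :=
      add_tsub_assoc_of_le (Finsupp.single_le_iff.2
        (Nat.one_le_iff_ne_zero.2 (Finsupp.mem_support_iff.1 hj))) _
    by_cases h4 : ∀ k < i, b k = 0
    · rw [if_pos h4, if_pos (h2.2 h4), h3]
    · rw [if_neg h4, if_neg (h2.not.2 h4)]
  · rw [if_neg (fun h => hj (h1.1 h)), if_neg hj, ite_self]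

theorem divFirst_X_mul_of_gt {i j : σ} (hij : j < i) (p : MvPolynomial σ R) :
    divFirst i (X j * p) = 0 := by
  ext b
  rw [coeff_divFirst, coeff_zero, coeff_X_mul']
  split_ifs with h1 h2
  · simp [Finsupp.single_eq_of_ne hij.ne, h1 j hij] at h2
  · rfl
  · rfl

theorem divFirst_X_mul_self (i : σ) (p : MvPolynomial σ R) :
    divFirst i (X i * p) = killBelow i p := by
  ext b
  rw [coeff_divFirst, coeff_killBelow, coeff_X_mul]

theorem divFirst_mem_map_C {I : Ideal R} {p : MvPolynomial σ R} (hp : p ∈ I.map C) (i : σ) :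
    divFirst i p ∈ I.map C := by
  rw [mem_map_C_iff] at hp ⊢
  intro b
  rw [coeff_divFirst]
  split_ifs
  · exact hp _
  · exact I.zero_mem

theorem divFirst_isHomogeneous {t : ℕ} {p : MvPolynomial σ R} (hp : p.IsHomogeneous (t + 1))
    (i : σ) : (divFirst i p).IsHomogeneous t := by
  intro b hb
  rw [coeff_divFirst] at hb
  split_ifs at hb with h
  · have h1 := hp hb
    rw [map_add, Finsupp.weight_single] at h1
    simp at h1
    omega
  · exact absurd rfl hb

open Classical in
theorem coeff_X_mul_divFirst (i : σ) (p : MvPolynomial σ R) (b : σ →₀ ℕ) :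
    coeff b (X i * divFirst i p) = if b i ≠ 0 ∧ ∀ k < i, b k = 0 then coeff b p else 0 := by
  rw [coeff_X_mul', coeff_divFirst]
  by_cases hi : b i = 0
  · simp [hi]
  · have h2 : (∀ k < i, (b - Finsupp.single i 1 : σ →₀ ℕ) k = 0) ↔ ∀ k < i, b k = 0 :=
      forall₂_congr fun k hk => by simp [Finsupp.single_eq_of_ne hk.ne]
    rw [if_pos (Finsupp.mem_support_iff.2 hi), if_congr h2 rfl rfl, add_tsub_cancel_of_le
      (Finsupp.single_le_iff.2 (Nat.one_le_iff_ne_zero.2 hi))]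
    simp [hi]

variable [Fintype σ]

open Classical in
/-- If a lower set of variables meets the monomial `b`, then exactly one of the variables in it is
the first one of `b`. -/
theorem sum_coeff_X_mul_divFirst (T : Finset σ) (hT : IsLowerSet (T : Set σ))
    (p : MvPolynomial σ R) (b : σ →₀ ℕ) :
    ∑ j ∈ T, coeff b (X j * divFirst j p) = if ∀ k ∈ T, b k = 0 then 0 else coeff b p := by
  simp only [coeff_X_mul_divFirst]
  split_ifs with h
  · exact Finset.sum_eq_zero fun j hj => if_neg fun h' => h'.1 (h j hj)
  · push Not at h
    obtain ⟨k, hk, hbk⟩ := h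
    have hne : (T.filter fun k => b k ≠ 0).Nonempty := ⟨k, by simp [hk, hbk]⟩
    have hq := Finset.min'_mem _ hne
    set q := Finset.min' _ hne
    rw [Finset.mem_filter] at hq
    have hmin : ∀ l ∈ T, b l ≠ 0 → q ≤ l := fun l hl hbl =>
      Finset.min'_le _ _ (Finset.mem_filter.2 ⟨hl, hbl⟩)
    have hlt : ∀ l < q, b l = 0 := fun l hl => by
      by_contra hbl
      exact absurd (hmin l (hT hl.le hq.1) hbl) (not_le.2 hl)
    rw [Finset.sum_eq_single q, if_pos ⟨hq.2, hlt⟩]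
    · intro j hj hjq
      refine if_neg fun h' => ?_
      rcases lt_or_gt_of_ne hjq with h1 | h1
      · exact h'.1 (hlt j h1)
      · exact hq.2 (h'.2 q h1)
    · exact fun h' => absurd hq.1 h'

/-- Sorts the monomials of p by their first variable: those starting before i appear once in the
sum, all others survive in `killBelow`. -/
theorem sum_X_mul_divFirst_add_killBelow (i : σ) (p : MvPolynomial σ R) :
    ∑ j ∈ Finset.univ.filter (· < i), X j * divFirst j p + killBelow i p = p := by
  ext b
  rw [coeff_add, coeff_sum, sum_coeff_X_mul_divFirst _ (by
    intro x y hyx hx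
    simp only [Finset.coe_filter, Finset.mem_univ, true_and, Set.mem_ofPred_eq] at hx ⊢
    exact hyx.trans_lt hx), coeff_killBelow]
  simp only [Finset.mem_filter, Finset.mem_univ, true_and]
  split_ifs <;> simp

theorem sum_X_mul_divFirst {p : MvPolynomial σ R} (hp : coeff 0 p = 0) :
    ∑ j, X j * divFirst j p = p := by
  ext b
  rw [coeff_sum, sum_coeff_X_mul_divFirst _ (by simpa using isLowerSet_univ)]
  split_ifs with h
  · rw [show b = 0 from Finsupp.ext fun k => h k (Finset.mem_univ k), hp]
  · rfl

/-- The contracting homotopy of the Koszul complex of the variables. -/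
noncomputable def koszulHomotopy (F : Finset σ → MvPolynomial σ R) (S : Finset σ) :
    MvPolynomial σ R :=
  if h : S.Nonempty then divFirst (S.min' h) (F (S.erase (S.min' h))) else 0

omit [Fintype σ] in
theorem koszulHomotopy_insert (F : Finset σ → MvPolynomial σ R) {i : σ} {S : Finset σ}
    (hi : ∀ x ∈ S, i < x) : koszulHomotopy F (insert i S) = divFirst i (F S) := by
  have hm : (insert i S).min' (Finset.insert_nonempty i S) = i := by
    refine le_antisymm (Finset.min'_le _ _ (Finset.mem_insert_self i S)) ?_
    refine Finset.le_min' _ _ _ fun y hy => ?_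
    rcases Finset.mem_insert.1 hy with rfl | hy
    · exact le_rfl
    · exact (hi y hy).le
  rw [koszulHomotopy, dif_pos (Finset.insert_nonempty i S), hm,
    Finset.erase_insert fun h => lt_irrefl i (hi i h)]

omit [Fintype σ] in
theorem exists_eq_insert_min {S : Finset σ} (hS : S.Nonempty) :
    ∃ i S', S = insert i S' ∧ ∀ x ∈ S', i < x :=
  ⟨S.min' hS, S.erase (S.min' hS), (Finset.insert_erase (S.min'_mem hS)).symm,
    fun _ hx => Finset.min'_lt_of_mem_erase_min' S hS hx⟩

omit [LinearOrder σ] [Fintype σ] in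
theorem neg_one_pow_eq_C (n : ℕ) :
    ((-1) ^ n : MvPolynomial σ R) = C (σ := σ) ((-1 : R) ^ n) := by simp

/-- Let p be the first variable of S. In dh + hd, the terms with j > p cancel by sign; those with j
< p occur only in dh and give the monomials of F S starting before p; the term j = p of hd gives the
rest. Only the constant term at ∅ cannot be recovered, whence `hF`. -/
theorem koszulD_koszulHomotopy_add (F : Finset σ → MvPolynomial σ R) (S : Finset σ)
    (hF : S = ∅ → coeff 0 (F ∅) = 0) :
    koszulD (R := MvPolynomial σ R) X (koszulHomotopy F) S +
      koszulHomotopy (koszulD (R := MvPolynomial σ R) X F) S = F S := by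
  rcases S.eq_empty_or_nonempty with rfl | hS
  · rw [koszulHomotopy, dif_neg Finset.not_nonempty_empty, add_zero, koszulD_apply,
      Finset.compl_empty]
    refine Eq.trans (Finset.sum_congr rfl fun j _ => ?_) (sum_X_mul_divFirst (hF rfl))
    rw [koszulHomotopy_insert F (by simp), koszulSign_of_forall_le (by simp), one_mul,
      smul_eq_mul]
  · obtain ⟨p, S, rfl, hp⟩ := exists_eq_insert_min hS
    have hpS : p ∉ S := fun h => lt_irrefl p (hp p h)
    have hc : (Sᶜ : Finset σ) = insert p (insert p S)ᶜ := by
      ext x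
      simp only [Finset.mem_compl, Finset.mem_insert]
      by_cases hx : x = p
      · simp [hx, hpS]
      · simp [hx]
    rw [koszulHomotopy_insert _ hp, koszulD_apply, koszulD_apply, hc,
      Finset.sum_insert (by simp), koszulSign_of_forall_le fun x hx => (hp x hx).le, one_mul,
      smul_eq_mul]
    have hadd : ∀ a b : MvPolynomial σ R, divFirst p (a + b) = divFirst p a + divFirst p b := by
      intro a b
      have := divFirst_sum p Finset.univ ![a, b]
      simpa using this
    rw [hadd, divFirst_X_mul_self, divFirst_sum, add_comm (killBelow p _), ← add_assoc,
      ← Finset.sum_add_distrib]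
    refine Eq.trans ?_ (sum_X_mul_divFirst_add_killBelow p (F (insert p S)))
    congr 1
    have hfil : Finset.univ.filter (· < p) = (insert p S)ᶜ.filter (· < p) := by
      ext x
      simp only [Finset.mem_filter, Finset.mem_univ, true_and, Finset.mem_compl,
        Finset.mem_insert, not_or]
      exact ⟨fun h => ⟨⟨h.ne, fun hx => lt_asymm h (hp x hx)⟩, h⟩, fun h => h.2⟩
    rw [hfil, Finset.sum_filter]
    refine Finset.sum_congr rfl fun j hj => ?_
    simp only [Finset.mem_compl, Finset.mem_insert, not_or] at hj
    rw [smul_eq_mul, smul_eq_mul, koszulSign, koszulSign, neg_one_pow_eq_C, neg_one_pow_eq_C,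
      mul_assoc (C _) (X j), mul_assoc (C _) (X j), divFirst_C_mul]
    split_ifs with hjp
    · have hlt : ∀ x ∈ insert p S, j < x := fun x hx => by
        rcases Finset.mem_insert.1 hx with rfl | hx
        · exact hjp
        · exact hjp.trans (hp x hx)
      rw [divFirst_X_mul_of_gt hjp, mul_zero, add_zero, koszulHomotopy_insert _ hlt,
        Finset.filter_false_of_mem fun x hx => not_lt.2 (hlt x hx).le]
      simp
    · have hpj : p < j := lt_of_le_of_ne (not_lt.1 hjp) (Ne.symm hj.1)
      have hlt : ∀ x ∈ insert j S, p < x := fun x hx => by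
        rcases Finset.mem_insert.1 hx with rfl | hx
        · exact hpj
        · exact hp x hx
      rw [divFirst_X_mul_of_lt hpj, Finset.insert_comm j p, koszulHomotopy_insert _ hlt,
        Finset.filter_insert, if_pos hpj, Finset.card_insert_of_notMem
        (fun h => hpS (Finset.mem_of_mem_filter _ h)), pow_succ]
      simp only [mul_neg, mul_one, map_neg]
      ring

theorem KoszulSupported.koszulHomotopy {n : ℕ} {F : Finset σ → MvPolynomial σ R}
    (hF : KoszulSupported Finset.univ n F) :
    KoszulSupported Finset.univ (n + 1) (koszulHomotopy F) := by
  intro S hS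
  refine ⟨?_, Finset.subset_univ S⟩
  have hne : S.Nonempty := by
    by_contra h
    exact hS (dif_neg h)
  obtain ⟨p, S, rfl, hp⟩ := exists_eq_insert_min hne
  rw [koszulHomotopy_insert _ hp] at hS
  rw [Finset.card_insert_of_notMem fun h => lt_irrefl p (hp p h),
    (hF S fun h => hS (by rw [h, divFirst_zero])).1]

-- The homotopy only relocates coefficients, so it transports divisibility by I from dF back to F =
-- hdF.
omit [Fintype σ] in
theorem koszulHomotopy_mem_map_C {I : Ideal R} {F : Finset σ → MvPolynomial σ R}
    (hF : ∀ S, F S ∈ I.map C) (S : Finset σ) : koszulHomotopy F S ∈ I.map C := by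
  rw [koszulHomotopy]
  split_ifs
  · exact divFirst_mem_map_C (hF _) _
  · exact zero_mem _

omit [Fintype σ] in
theorem koszulHomotopy_isHomogeneous {t : ℕ} {F : Finset σ → MvPolynomial σ R}
    (hF : ∀ S, (F S).IsHomogeneous (t + 1)) (S : Finset σ) :
    (koszulHomotopy F S).IsHomogeneous t := by
  rw [koszulHomotopy]
  split_ifs
  · exact divFirst_isHomogeneous (hF _) _
  · exact isHomogeneous_zero _ _ _

theorem koszulD_X_isHomogeneous {t : ℕ} {F : Finset σ → MvPolynomial σ R}
    (hF : ∀ S, (F S).IsHomogeneous t) (S : Finset σ) :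
    (koszulD (R := MvPolynomial σ R) X F S).IsHomogeneous (t + 1) := by
  rw [koszulD_apply]
  refine IsHomogeneous.sum _ _ _ fun j _ => ?_
  rw [smul_eq_mul, koszulSign, neg_one_pow_eq_C, mul_assoc]
  refine IsHomogeneous.C_mul ?_ _
  rw [add_comm]
  exact (isHomogeneous_X _ _).mul (hF _)

/-! ### Quasi-regularity and primitives with coefficients in powers of I. -/

theorem koszulD_mem_pow_succ (r : σ → R) {t : ℕ} {f : Finset σ → R}
    (hf : ∀ S, f S ∈ Ideal.span (Set.range r) ^ t) (S : Finset σ) :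
    koszulD r f S ∈ Ideal.span (Set.range r) ^ (t + 1) := by
  rw [koszulD_apply]
  refine Ideal.sum_mem _ fun j _ => ?_
  rw [smul_eq_mul, mul_assoc, pow_succ']
  exact Ideal.mul_mem_left _ _ (Ideal.mul_mem_mul (Ideal.subset_span ⟨j, rfl⟩) (hf _))

theorem eval_koszulD (r : σ → R) (F : Finset σ → MvPolynomial σ R) (S : Finset σ) :
    eval r (koszulD (R := MvPolynomial σ R) X F S) = koszulD r (fun S => eval r (F S)) S := by
  simp only [koszulD_apply, map_sum, smul_eq_mul, map_mul, map_koszulSign, eval_X]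

omit [LinearOrder σ] [Fintype σ] in
theorem eval_mem_pow_succ (r : σ → R) {t : ℕ} {p : MvPolynomial σ R} (hp : p.IsHomogeneous t)
    (hpI : p ∈ (Ideal.span (Set.range r)).map C) :
    eval r p ∈ Ideal.span (Set.range r) ^ (t + 1) := by
  rw [mem_map_C_iff] at hpI
  rw [p.as_sum, map_sum]
  refine Ideal.sum_mem _ fun b hb => ?_
  have h1 : monomial b (coeff b p) = C (coeff b p) * monomial b 1 := by
    rw [C_mul_monomial, mul_one]
  rw [h1, map_mul, eval_C, pow_succ']
  refine Ideal.mul_mem_mul (hpI b) ((Ideal.mem_span_pow_iff_exists_isHomogeneous r _).2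
    ⟨_, ?_, rfl⟩)
  have := hp (mem_support_iff.1 hb)
  refine isHomogeneous_monomial _ ?_
  rw [← this, Finsupp.degree_eq_weight_one]
  rfl

omit [LinearOrder σ] in
theorem exists_koszul_lift (r : σ → R) {k t : ℕ} {w : Finset σ → R}
    (hw : KoszulSupported Finset.univ k w) (hwI : ∀ S, w S ∈ Ideal.span (Set.range r) ^ t) :
    ∃ F : Finset σ → MvPolynomial σ R, KoszulSupported Finset.univ k F ∧
      (∀ S, (F S).IsHomogeneous t) ∧ ∀ S, eval r (F S) = w S := by
  classical
  choose G hG hGw using fun S => (Ideal.mem_span_pow_iff_exists_isHomogeneous r _).1 (hwI S)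
  -- An arbitrary lift of 0 could be nonzero; choosing 0 there preserves the exterior degree.
  refine ⟨fun S => if w S = 0 then 0 else G S, fun S hS => ?_, fun S => ?_, fun S => ?_⟩
  · by_cases h : w S = 0
    · exact absurd (if_pos h) hS
    · exact hw S h
  · dsimp only
    split_ifs
    · exact isHomogeneous_zero _ _ _
    · exact hG S
  · dsimp only
    split_ifs with h
    · rw [h, map_zero]
    · exact hGw S

/-- A homogeneous polynomial of degree `t` whose value at `r` lies in the power `I ^ (t + 1)` of
the ideal generated by `r` has its coefficients in `I`. -/
def IsQuasiRegularIn (r : σ → R) (t : ℕ) : Prop :=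
  ∀ p : MvPolynomial σ R, p.IsHomogeneous t → eval r p ∈ Ideal.span (Set.range r) ^ (t + 1) →
    p ∈ (Ideal.span (Set.range r)).map C

/-- Every Koszul chain with coefficients in a power of `I` has the same boundary as
one which is the value of a chain `F` of homogeneous polynomials in the range of the homotopy. -/
theorem exists_koszulHomotopy_eq (r : σ → R) {k t : ℕ} {w : Finset σ → R}
    (hw : KoszulSupported Finset.univ (k + 1) w)
    (hwI : ∀ S, w S ∈ Ideal.span (Set.range r) ^ t) :
    ∃ F : Finset σ → MvPolynomial σ R, KoszulSupported Finset.univ (k + 1) F ∧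
      (∀ S, (F S).IsHomogeneous t) ∧ koszulHomotopy (koszulD (R := MvPolynomial σ R) X F) = F ∧
      koszulD r (fun S => eval r (F S)) = koszulD r w := by
  obtain ⟨G, hG, hGt, hGw⟩ := exists_koszul_lift r hw hwI
  have hG0 : ∀ S : Finset σ, S = ∅ → coeff 0 (G ∅) = 0 := fun S _ => by
    rw [hG.eq_zero fun h => absurd h (by simp), coeff_zero]
  -- G and hdG differ by the boundary dhG, so they have the same boundary.
  have h1 : koszulHomotopy (koszulD (R := MvPolynomial σ R) X G) =
      G - koszulD (R := MvPolynomial σ R) X (koszulHomotopy G) :=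
    funext fun S => eq_sub_of_add_eq' (koszulD_koszulHomotopy_add G S (hG0 S))
  have h2 : koszulD (R := MvPolynomial σ R) X (koszulHomotopy (koszulD (R := MvPolynomial σ R) X G)) =
      koszulD (R := MvPolynomial σ R) X G := by
    rw [h1, map_sub, koszulD_koszulD, sub_zero]
  refine ⟨koszulHomotopy (koszulD (R := MvPolynomial σ R) X G),
    (hG.koszulD (R := MvPolynomial σ R) X).koszulHomotopy,
    koszulHomotopy_isHomogeneous (koszulD_X_isHomogeneous hGt), by rw [h2], ?_⟩
  ext S
  rw [← eval_koszulD, h2, eval_koszulD]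
  simp only [hGw]

/-- Boundaries in the Koszul complex detect the coefficients of a chain of polynomials in the
range of the homotopy. -/
theorem IsQuasiRegularIn.mem_map_C_of_koszulD {r : σ → R} {t : ℕ}
    (hQ : IsQuasiRegularIn r (t + 1)) {F : Finset σ → MvPolynomial σ R}
    (hFt : ∀ S, (F S).IsHomogeneous t)
    (hF : koszulHomotopy (koszulD (R := MvPolynomial σ R) X F) = F)
    (hd : ∀ S, koszulD r (fun S => eval r (F S)) S ∈ Ideal.span (Set.range r) ^ (t + 2))
    (S : Finset σ) : F S ∈ (Ideal.span (Set.range r)).map C := by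
  rw [← hF]
  refine koszulHomotopy_mem_map_C (fun S => hQ _ (koszulD_X_isHomogeneous hFt S) ?_) S
  rw [eval_koszulD]
  exact hd S

/-- Induction on s: lift a primitive over I^s to a chain F = hdF. Its boundary takes values in
I^(s+2), so F has coefficients in I and its value lies over I^(s+1). Quasi-regularity is assumed
only up to degree s so that the lemma can serve inside the induction proving it. -/
theorem IsRegularFamily.exists_koszulD_eq_of_isQuasiRegularIn {r : σ → R}
    (hr : IsRegularFamily r) (s : ℕ) (hQ : ∀ t ≤ s, IsQuasiRegularIn r t) {n : ℕ}
    {z : Finset σ → R} (hz : KoszulSupported Finset.univ n z) (hdz : koszulD r z = 0)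
    (hzI : ∀ S, z S ∈ Ideal.span (Set.range r) ^ (s + 1)) :
    ∃ w, KoszulSupported Finset.univ (n + 1) w ∧ koszulD r w = z ∧
      ∀ S, w S ∈ Ideal.span (Set.range r) ^ s := by
  induction s with
  | zero =>
    obtain ⟨w, hw, hwz⟩ := hr.koszul_exact hz hdz (by simpa using hzI ∅)
    exact ⟨w, hw, hwz, by simp⟩
  | succ s ih =>
    obtain ⟨w, hw, hwz, hwI⟩ := ih (fun t ht => hQ t (ht.trans (Nat.le_succ s)))
      (fun S => Ideal.pow_le_pow_right (Nat.le_succ _) (hzI S))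
    obtain ⟨F, hF, hFt, hFh, hFw⟩ := exists_koszulHomotopy_eq r hw hwI
    refine ⟨fun S => eval r (F S), fun S hS => hF S fun h => hS (by simp [h]),
      hFw.trans hwz, fun S => eval_mem_pow_succ r (hFt S) ?_⟩
    refine (hQ (s + 1) le_rfl).mem_map_C_of_koszulD hFt hFh (fun S => ?_) S
    rw [hFw, hwz]
    exact hzI S

theorem koszulD_apply_empty (r : σ → R) (f : Finset σ → R) :
    koszulD r f ∅ = ∑ j, r j * f {j} := by
  rw [koszulD_apply, Finset.compl_empty]
  refine Finset.sum_congr rfl fun j _ => ?_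
  rw [koszulSign_of_forall_le (by simp), one_mul, smul_eq_mul, insert_empty_eq]

/-- A regular sequence is quasi-regular. -/
theorem IsRegularFamily.isQuasiRegularIn {r : σ → R} (hr : IsRegularFamily r) (t : ℕ) :
    IsQuasiRegularIn r t := by
  induction t using Nat.strong_induction_on with
  | _ t ih =>
  intro p hp hpI
  cases t with
  | zero =>
    obtain ⟨c, rfl⟩ : ∃ c, p = C c := ⟨_, (totalDegree_eq_zero_iff_eq_C).1
      (Nat.le_zero.1 hp.totalDegree_le)⟩
    simpa using Ideal.mem_map_of_mem C (by simpa using hpI)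
  | succ t =>
    have hp0 : coeff 0 p = 0 := by
      by_contra h
      have := hp h
      simp at this
    have hpsum := sum_X_mul_divFirst hp0
    have hpt := divFirst_isHomogeneous hp
    -- Here p has degree t + 1 and q has degree t + 2 with the same value at r. Splitting both by
    -- first variables turns equality of values into a relation ∑ r i * v i = 0, that is, a Koszul
    -- 1-cycle over I^t.
    obtain ⟨q, hq, hqp⟩ := (Ideal.mem_span_pow_iff_exists_isHomogeneous r _).1 hpI
    have hq0 : coeff 0 q = 0 := by
      by_contra h
      have := hq h
      simp at this
    have hqsum := sum_X_mul_divFirst hq0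
    have hqt := divFirst_isHomogeneous hq
    let v : σ → R := fun i => eval r (divFirst i p) - eval r (divFirst i q)
    have hv : ∀ i, v i ∈ Ideal.span (Set.range r) ^ t := fun i =>
      sub_mem ((Ideal.mem_span_pow_iff_exists_isHomogeneous r _).2 ⟨_, hpt i, rfl⟩)
        (Ideal.pow_le_pow_right (Nat.le_succ t)
          ((Ideal.mem_span_pow_iff_exists_isHomogeneous r _).2 ⟨_, hqt i, rfl⟩))
    let z : Finset σ → R := fun S => if h : S.card = 1 then v (S.min' (by
      rw [← Finset.card_pos, h]; exact one_pos)) else 0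
    have hz1 : ∀ i, z {i} = v i := fun i => by simp [z]
    have hz : KoszulSupported Finset.univ 1 z := fun S hS => by
      refine ⟨?_, Finset.subset_univ S⟩
      by_contra h
      exact hS (dif_neg h)
    have hzI : ∀ S, z S ∈ Ideal.span (Set.range r) ^ t := fun S => by
      simp only [z]
      split_ifs
      · exact hv _
      · exact zero_mem _
    have hdz : koszulD r z = 0 := by
      ext S
      by_cases hS : S = ∅
      · rw [hS, koszulD_apply_empty, Pi.zero_apply]
        simp only [hz1, v, mul_sub, Finset.sum_sub_distrib]
        have h1 := congrArg (eval r) hpsum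
        have h2 := congrArg (eval r) hqsum
        simp only [map_sum, map_mul, eval_X] at h1 h2
        rw [h1, h2, hqp, sub_self]
      · exact (hz.koszulD r).eq_zero fun h => absurd (Finset.card_eq_zero.1 h) hS
    rw [← hpsum]
    have hqi : ∀ i, eval r (divFirst i q) ∈ Ideal.span (Set.range r) ^ (t + 1) := fun i =>
      (Ideal.mem_span_pow_iff_exists_isHomogeneous r _).2 ⟨_, hqt i, rfl⟩
    cases t with
    | zero =>
      -- For t = 0 the cycle is a boundary by acyclicity, so its coefficients lie in I, and so do
      -- the constants `divFirst i p`.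
      refine Ideal.sum_mem _ fun i _ => Ideal.mul_mem_left _ _ (ih 0 one_pos _ (hpt i) ?_)
      obtain ⟨w, hw, hwz⟩ := hr.koszul_exact hz hdz (by
        rw [hz.eq_zero fun h => absurd h (by simp)]
        exact zero_mem _)
      have h1 : eval r (divFirst i p) = koszulD r w {i} + eval r (divFirst i q) := by
        rw [hwz, hz1, sub_add_cancel]
      rw [h1]
      exact add_mem (koszulD_mem_pow_succ r (t := 0) (by simp) _) (hqi i)
    | succ t =>
      obtain ⟨w, hw, hwz, hwI⟩ := hr.exists_koszulD_eq_of_isQuasiRegularIn t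
        (fun u hu => ih u (by omega)) hz hdz hzI
      obtain ⟨F, hF, hFt, hFw⟩ := exists_koszul_lift r hw hwI
      -- Subtracting the lifted boundary leaves the value of `divFirst i q`, which lies deep enough
      -- for the induction hypothesis. By d² = 0 the subtracted terms contribute nothing to ∑ X i *
      -- divFirst i p.
      have h1 : ∀ i, divFirst i p - koszulD (R := MvPolynomial σ R) X F {i} ∈
          (Ideal.span (Set.range r)).map C := by
        intro i
        refine ih (t + 1) (by omega) _ ((hpt i).sub (koszulD_X_isHomogeneous hFt _)) ?_
        rw [map_sub, eval_koszulD, funext hFw, hwz, hz1, sub_sub_cancel]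
        exact hqi i
      have h2 : ∑ i, X i * koszulD (R := MvPolynomial σ R) X F {i} = 0 := by
        rw [← koszulD_apply_empty, koszulD_koszulD, Pi.zero_apply]
      rw [← sub_zero (∑ i, X i * divFirst i p), ← h2, ← Finset.sum_sub_distrib]
      refine Ideal.sum_mem _ fun i _ => ?_
      rw [← mul_sub]
      exact Ideal.mul_mem_left _ _ (h1 i)

theorem IsRegularFamily.exists_koszulD_eq {r : σ → R} (hr : IsRegularFamily r) {s n : ℕ}
    {z : Finset σ → R} (hz : KoszulSupported Finset.univ n z) (hdz : koszulD r z = 0)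
    (hzI : ∀ S, z S ∈ Ideal.span (Set.range r) ^ (s + 1)) :
    ∃ w, KoszulSupported Finset.univ (n + 1) w ∧ koszulD r w = z ∧
      ∀ S, w S ∈ Ideal.span (Set.range r) ^ s :=
  hr.exists_koszulD_eq_of_isQuasiRegularIn s (fun t _ => hr.isQuasiRegularIn t) hz hdz hzI

end Polynomial

/-! ### Free modules over R/I and transport of exactness. -/

section ModuleLemmas

variable {R : Type*} [CommRing R] {I : Ideal R}

/-- Since T is already an R/I-module, Φ descends to finitely supported functions with values in R/I,
and `hker` makes the descended map injective. -/
theorem Module.Free.of_isReduction {V T H : Type*} [AddCommGroup T] [Module R T]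
    [Module (R ⧸ I) T] [IsScalarTower R (R ⧸ I) T] [AddCommGroup H] [Module R H]
    (e : T ≃ₗ[R] H) (Φ : (V →₀ R) →ₗ[R] H) (hsurj : Function.Surjective Φ)
    (hker : ∀ c, Φ c = 0 ↔ ∀ v, c v ∈ I) : Module.Free (R ⧸ I) T := by
  let L : (V →₀ R ⧸ I) →ₗ[R ⧸ I] T :=
    Finsupp.linearCombination (R ⧸ I) fun v => e.symm (Φ (Finsupp.single v 1))
  let q : (V →₀ R) →ₗ[R] (V →₀ R ⧸ I) :=
    Finsupp.mapRange.linearMap (Algebra.linearMap R (R ⧸ I))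
  have hq : Function.Surjective q :=
    Finsupp.mapRange_surjective _ (map_zero _) Ideal.Quotient.mk_surjective
  have hLq : ∀ c, L (q c) = e.symm (Φ c) := by
    have : (L.restrictScalars R) ∘ₗ q = e.symm.toLinearMap ∘ₗ Φ := by
      ext v
      simp [L, q]
    exact fun c => LinearMap.congr_fun this c
  refine Module.Free.of_equiv (LinearEquiv.ofBijective L ⟨?_, ?_⟩)
  · refine (injective_iff_map_eq_zero L).2 fun c hc => ?_
    obtain ⟨c, rfl⟩ := hq c
    rw [hLq, map_eq_zero_iff _ e.symm.injective, hker] at hc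
    ext v
    exact Ideal.Quotient.eq_zero_iff_mem.2 (hc v)
  · intro t
    obtain ⟨c, hc⟩ := hsurj (e t)
    exact ⟨q c, by rw [hLq, hc, e.symm_apply_apply]⟩

/-- A free quotient is projective, so the sequence splits. -/
theorem Module.Free.of_exact {A M N P : Type*} [Ring A] [AddCommGroup M] [AddCommGroup N]
    [AddCommGroup P] [Module A M] [Module A N] [Module A P] [Module.Free A M] [Module.Free A P]
    {f : M →ₗ[A] N} {g : N →ₗ[A] P} (hf : Function.Injective f) (hfg : Function.Exact f g)
    (hg : Function.Surjective g) : Module.Free A N := by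
  obtain ⟨l, hl⟩ := Module.projective_lifting_property g LinearMap.id hg
  exact Module.Free.of_equiv (hfg.splitSurjectiveEquiv hf ⟨l, hl⟩).1.symm

theorem Function.Exact.of_squares {A B C A' B' C' : Type*} [Zero C] [Zero C'] {f : A → B}
    {g : B → C} {f' : A' → B'} {g' : B' → C'} (h : Function.Exact f' g') {a : A → A'}
    {b : B → B'} {c : C → C'} (ha : Function.Surjective a) (hb : Function.Injective b)
    (hc : ∀ x, c x = 0 ↔ x = 0) (hf : ∀ x, b (f x) = f' (a x)) (hg : ∀ x, c (g x) = g' (b x)) :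
    Function.Exact f g := by
  intro x
  rw [← hc, hg, h]
  constructor
  · rintro ⟨y, hy⟩
    obtain ⟨y, rfl⟩ := ha y
    exact ⟨y, hb ((hf y).trans hy)⟩
  · rintro ⟨y, rfl⟩
    exact ⟨a y, (hf y).symm⟩

end ModuleLemmas

/-! ### Homology of complexes of modules in terms of elements. -/

section Homology

variable {R : Type u} [CommRing R] (C : ChainComplex (ModuleCat.{u} R) ℕ) (n : ℕ)

theorem homologyπ_surjective : Function.Surjective (C.homologyπ n) :=
  (ModuleCat.epi_iff_surjective _).1 inferInstance

theorem homologyπ_eq_zero_iff (z : C.cycles n) :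
    C.homologyπ n z = 0 ↔ ∃ y, C.d (n + 1) n y = C.iCycles n z := by
  have hex := (ShortComplex.ShortExact.moduleCat_exact_iff_function_exact _).1
    (ShortComplex.exact_of_g_is_cokernel (ShortComplex.mk _ _
      (C.toCycles_comp_homologyπ (n + 1) n)) (C.homologyIsCokernel (n + 1) n (by simp)))
  have hinj : Function.Injective (C.iCycles n) :=
    (ModuleCat.mono_iff_injective _).1 inferInstance
  refine (hex z).trans (exists_congr fun y => ?_)
  rw [← hinj.eq_iff]
  exact Eq.congr_left (congrArg (fun φ => φ.hom y) (C.toCycles_i (n + 1) n))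

theorem exists_cycle (x : C.X n) (hx : C.d n ((ComplexShape.down ℕ).next n) x = 0) :
    ∃ z, C.iCycles n z = x :=
  ((ShortComplex.ShortExact.moduleCat_exact_iff_function_exact _).1
    (ShortComplex.exact_of_f_is_kernel (ShortComplex.mk _ _
      (C.iCycles_d n ((ComplexShape.down ℕ).next n))) (C.cyclesIsKernel n _ rfl)) x).1 hx

theorem d_iCycles (z : C.cycles n) (j : ℕ) : C.d n j (C.iCycles n z) = 0 :=
  congrArg (fun φ => φ.hom z) (C.iCycles_d n j)

variable {C n}

/-- If the classes of the cycles `ψ c` exhaust the homology, and exactly those with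
coefficients in `I` vanish, then the homology is free over `R ⧸ I`. -/
theorem Module.Free.of_homology {I : Ideal R} {T : Type*} [AddCommGroup T] [Module R T]
    [Module (R ⧸ I) T] [IsScalarTower R (R ⧸ I) T] (e : T ≃ₗ[R] C.homology n) {V : Type}
    (ψ : (V →₀ R) →ₗ[R] C.X n)
    (hψ : ∀ c, C.d n ((ComplexShape.down ℕ).next n) (ψ c) = 0)
    (hsurj : ∀ x, C.d n ((ComplexShape.down ℕ).next n) x = 0 →
      ∃ c y, x = ψ c + C.d (n + 1) n y)
    (hker : ∀ c, (∃ y, C.d (n + 1) n y = ψ c) ↔ ∀ v, c v ∈ I) : Module.Free (R ⧸ I) T := by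
  let φ : ModuleCat.of R (V →₀ R) ⟶ C.cycles n :=
    C.liftCycles (ModuleCat.ofHom ψ) _ rfl (ModuleCat.hom_ext (LinearMap.ext hψ))
  have hφ : ∀ c, C.iCycles n (φ c) = ψ c := fun c =>
    congrArg (fun f => f.hom c) (C.liftCycles_i (ModuleCat.ofHom ψ) _ rfl
      (ModuleCat.hom_ext (LinearMap.ext hψ)))
  refine Module.Free.of_isReduction e (φ ≫ C.homologyπ n).hom ?_ ?_
  · intro h
    obtain ⟨z, rfl⟩ := homologyπ_surjective C n h
    obtain ⟨c, y, hcy⟩ := hsurj _ (d_iCycles C n z _)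
    refine ⟨c, ?_⟩
    have h1 : C.homologyπ n (z - φ c) = 0 := by
      rw [homologyπ_eq_zero_iff]
      exact ⟨y, by rw [map_sub, hφ, hcy, add_sub_cancel_left]⟩
    rw [map_sub, sub_eq_zero] at h1
    exact h1.symm
  · intro c
    refine Iff.trans ?_ (hker c)
    rw [← hφ]
    exact homologyπ_eq_zero_iff C n (φ c)

theorem homologyMap_eq_zero {D : ChainComplex (ModuleCat.{u} R) ℕ} (f : C ⟶ D)
    (hf : ∀ x, C.d n ((ComplexShape.down ℕ).next n) x = 0 → ∃ y, D.d (n + 1) n y = f.f n x) :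
    HomologicalComplex.homologyMap f n = 0 := by
  rw [← cancel_epi (C.homologyπ n), Limits.comp_zero, HomologicalComplex.homologyπ_naturality]
  ext z
  refine (homologyπ_eq_zero_iff D n _).2 ?_
  obtain ⟨y, hy⟩ := hf _ (d_iCycles C n z _)
  refine ⟨y, hy.trans ?_⟩
  exact (congrArg (fun φ => φ.hom z) (HomologicalComplex.cyclesMap_i f n)).symm

theorem homologyMap_zero_surjective {D : ChainComplex (ModuleCat.{u} R) ℕ} (f : C ⟶ D)
    (hf : Function.Surjective (f.f 0)) :
    Function.Surjective (HomologicalComplex.homologyMap f 0) := by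
  intro h
  obtain ⟨z, rfl⟩ := homologyπ_surjective D 0 h
  obtain ⟨x, hx⟩ := hf (D.iCycles 0 z)
  obtain ⟨w, hw⟩ := exists_cycle C 0 x (by
    rw [C.shape _ _ (by simp)]
    rfl)
  have hinj : Function.Injective (D.iCycles 0) :=
    (ModuleCat.mono_iff_injective _).1 inferInstance
  have h1 : HomologicalComplex.cyclesMap f 0 w = z := hinj (by
    rw [← hx, ← hw]
    exact congrArg (fun φ => φ.hom w) (HomologicalComplex.cyclesMap_i f 0))
  exact ⟨C.homologyπ 0 w, by
    rw [← h1]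
    exact congrArg (fun φ => φ.hom w) (HomologicalComplex.homologyπ_naturality f 0)⟩

end Homology

/-! ### The long exact sequence of Tor. -/

namespace RegularTor

section LongExact

variable {R : Type u} [CommRing R] (M : ModuleCat.{u} R)

/-- `Tor_n^R(M, N)` computed by a projective resolution of `M`. -/
noncomputable def torEquiv {M : ModuleCat.{u} R} (P : ProjectiveResolution M) (n : ℕ)
    (N : ModuleCat.{u} R) :
    TorObj n M N ≃ₗ[R] (((((tensoringRight (ModuleCat.{u} R)).obj N).mapHomologicalComplex
      (ComplexShape.down ℕ)).obj P.complex).homology n :) :=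
  (P.isoLeftDerivedObj ((tensoringRight (ModuleCat.{u} R)).obj N) n).toLinearEquiv

theorem torEquiv_torObjMap {M : ModuleCat.{u} R} (P : ProjectiveResolution M) (n : ℕ)
    {A B : ModuleCat.{u} R} (f : A ⟶ B) (x : TorObj n M A) :
    torEquiv P n B (torObjMap n M f x) =
      HomologicalComplex.homologyMap ((NatTrans.mapHomologicalComplex
        ((tensoringRight (ModuleCat.{u} R)).map f) (ComplexShape.down ℕ)).app P.complex) n
        (torEquiv P n A x) := by
  have h := ProjectiveResolution.leftDerived_app_eq ((tensoringRight (ModuleCat.{u} R)).map f) P n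
  have h2 : torObjMap n M f x = (torEquiv P n B).symm
      (HomologicalComplex.homologyMap ((NatTrans.mapHomologicalComplex
        ((tensoringRight (ModuleCat.{u} R)).map f) (ComplexShape.down ℕ)).app P.complex) n
        (torEquiv P n A x)) := congrArg (fun φ => φ.hom x) h
  rw [h2, LinearEquiv.apply_symm_apply]

variable {S : ShortComplex (ModuleCat.{u} R)} (hS : S.ShortExact) (n : ℕ)

theorem torEquiv_torObjδ (x : TorObj (n + 1) M S.X₃) :
    torEquiv (projectiveResolution M) n S.X₁ (torObjδ n M hS x) =
      (tensorShortComplex_shortExact (projectiveResolution M) hS).δ (n + 1) n (by simp)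
        (torEquiv (projectiveResolution M) (n + 1) S.X₃ x) :=
  (torEquiv (projectiveResolution M) n S.X₁).apply_symm_apply _

theorem torObj_exact₁ : Function.Exact (torObjδ n M hS) (torObjMap n M S.f) :=
  Function.Exact.of_squares ((ShortComplex.ShortExact.moduleCat_exact_iff_function_exact _).1
    ((tensorShortComplex_shortExact (projectiveResolution M) hS).homology_exact₁ (n + 1) n
      (by simp)))
    (torEquiv (projectiveResolution M) (n + 1) S.X₃).surjective
    (torEquiv (projectiveResolution M) n S.X₁).injective
    (fun _ => (torEquiv (projectiveResolution M) n S.X₂).map_eq_zero_iff)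
    (fun x => torEquiv_torObjδ M hS n x)
    (fun x => torEquiv_torObjMap (projectiveResolution M) n _ x)

include hS in
theorem torObj_exact₂ : Function.Exact (torObjMap n M S.f) (torObjMap n M S.g) :=
  Function.Exact.of_squares ((ShortComplex.ShortExact.moduleCat_exact_iff_function_exact _).1
    ((tensorShortComplex_shortExact (projectiveResolution M) hS).homology_exact₂ n))
    (torEquiv (projectiveResolution M) n S.X₁).surjective
    (torEquiv (projectiveResolution M) n S.X₂).injective
    (fun _ => (torEquiv (projectiveResolution M) n S.X₃).map_eq_zero_iff)
    (fun x => torEquiv_torObjMap (projectiveResolution M) n _ x)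
    (fun x => torEquiv_torObjMap (projectiveResolution M) n _ x)

theorem torObj_exact₃ : Function.Exact (torObjMap (n + 1) M S.g) (torObjδ n M hS) :=
  Function.Exact.of_squares ((ShortComplex.ShortExact.moduleCat_exact_iff_function_exact _).1
    ((tensorShortComplex_shortExact (projectiveResolution M) hS).homology_exact₃ (n + 1) n
      (by simp)))
    (torEquiv (projectiveResolution M) (n + 1) S.X₂).surjective
    (torEquiv (projectiveResolution M) (n + 1) S.X₃).injective
    (fun _ => (torEquiv (projectiveResolution M) n S.X₁).map_eq_zero_iff)
    (fun x => torEquiv_torObjMap (projectiveResolution M) (n + 1) _ x)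
    (fun x => torEquiv_torObjδ M hS n x)

-- Right exactness of the tensor product: every 0-chain is a cycle, so surjectivity on 0-chains
-- passes to homology.
include hS in
theorem torObjMap_zero_surjective : Function.Surjective (torObjMap 0 M S.g) := by
  have h := homologyMap_zero_surjective
    (tensorShortComplex (projectiveResolution M).complex S).g
    (LinearMap.lTensor_surjective ((projectiveResolution M).complex.X 0)
      hS.moduleCat_surjective_g)
  intro x
  obtain ⟨y, hy⟩ := h (torEquiv (projectiveResolution M) 0 S.X₃ x)
  obtain ⟨y, rfl⟩ := (torEquiv (projectiveResolution M) 0 S.X₂).surjective y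
  exact ⟨y, (torEquiv (projectiveResolution M) 0 S.X₃).injective
    ((torEquiv_torObjMap (projectiveResolution M) 0 S.g y).trans hy)⟩

end LongExact

end RegularTor

/-! ### The Koszul complex as a projective resolution of R/I. -/

section KoszulComplex

/-- The exterior monomials of degree `n`. -/
abbrev KoszulIndex (σ : Type) (n : ℕ) : Type := {S : Finset σ // S.card = n}

variable {σ : Type} {R : Type u} [CommRing R]

section Graded

variable (R) (M : Type*) [AddCommGroup M] [Module R M] (n : ℕ)

/-- Extension by zero of a Koszul chain of degree `n`. -/
def koszulExtend : (KoszulIndex σ n → M) →ₗ[R] (Finset σ → M) where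
  toFun f S := if h : S.card = n then f ⟨S, h⟩ else 0
  map_add' f g := by
    ext S
    by_cases h : S.card = n <;> simp [h]
  map_smul' c f := by
    ext S
    by_cases h : S.card = n <;> simp [h]

/-- The component of degree `n` of a Koszul chain. -/
def koszulRestrict : (Finset σ → M) →ₗ[R] (KoszulIndex σ n → M) :=
  LinearMap.funLeft R M Subtype.val

variable {R M n}

@[simp]
theorem koszulExtend_apply (f : KoszulIndex σ n → M) (S : KoszulIndex σ n) :
    koszulExtend R M n f S.1 = f S :=
  dif_pos S.2

theorem koszulExtend_supported [Fintype σ] (f : KoszulIndex σ n → M) :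
    KoszulSupported Finset.univ n (koszulExtend R M n f) := fun S hS =>
  ⟨by_contra fun h => hS (dif_neg h), Finset.subset_univ S⟩

theorem koszulExtend_koszulRestrict [Fintype σ] {f : Finset σ → M}
    (hf : KoszulSupported Finset.univ n f) :
    koszulExtend R M n (koszulRestrict R M n f) = f := by
  ext S
  by_cases h : S.card = n
  · exact dif_pos h
  · exact (dif_neg h).trans (hf.eq_zero fun h' => absurd h' h).symm

theorem koszulExtend_injective :
    Function.Injective (koszulExtend R M n : (KoszulIndex σ n → M) →ₗ[R] (Finset σ → M)) := by
  intro f g h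
  ext S
  rw [← koszulExtend_apply (R := R) f S, h, koszulExtend_apply]

end Graded

variable [LinearOrder σ] [Fintype σ] (r : σ → R)

section Differential

variable (M : Type*) [AddCommGroup M] [Module R M] (n : ℕ)

/-- The Koszul differential from degree `n + 1` to degree `n`. -/
def koszulDiff : (KoszulIndex σ (n + 1) → M) →ₗ[R] (KoszulIndex σ n → M) :=
  koszulRestrict R M n ∘ₗ koszulD r ∘ₗ koszulExtend R M (n + 1)

variable {M n}

theorem koszulExtend_koszulDiff (f : KoszulIndex σ (n + 1) → M) :
    koszulExtend R M n (koszulDiff r M n f) = koszulD r (koszulExtend R M (n + 1) f) :=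
  koszulExtend_koszulRestrict ((koszulExtend_supported f).koszulD r)

theorem koszulDiff_apply (f : KoszulIndex σ (n + 1) → M) (S : KoszulIndex σ n) :
    koszulDiff r M n f S =
      ∑ j ∈ S.1ᶜ, (koszulSign R j S.1 * r j) • koszulExtend R M (n + 1) f (insert j S.1) :=
  rfl

end Differential

/-- The Koszul complex of `r` with coefficients in `M`. -/
noncomputable def koszulComplex (M : ModuleCat.{u} R) : ChainComplex (ModuleCat.{u} R) ℕ :=
  ChainComplex.of (fun n => ModuleCat.of R (KoszulIndex σ n → M))
    (fun n => ModuleCat.ofHom (koszulDiff r M n)) fun n => by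
      refine ModuleCat.hom_ext (LinearMap.ext fun f =>
        koszulExtend_injective (R := R) (M := M) (n := n) ?_)
      change koszulExtend R M n (koszulDiff r M n (koszulDiff r M (n + 1) f)) = _
      rw [koszulExtend_koszulDiff, koszulExtend_koszulDiff, koszulD_koszulD]
      exact (map_zero _).symm

theorem koszulComplex_d (M : ModuleCat.{u} R) (n : ℕ) :
    (koszulComplex r M).d (n + 1) n = ModuleCat.ofHom (koszulDiff r M n) :=
  ChainComplex.of_d (fun n => ModuleCat.of R (KoszulIndex σ n → M))
    (fun n => ModuleCat.ofHom (koszulDiff r M n)) n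

/-- A Koszul chain of degree `n` as a function on all exterior monomials. -/
def koszulChain (M : ModuleCat.{u} R) (n : ℕ) :
    (koszulComplex r M).X n →ₗ[R] (Finset σ → M) :=
  koszulExtend R M n

theorem koszulChain_injective (M : ModuleCat.{u} R) (n : ℕ) :
    Function.Injective (koszulChain r M n) :=
  koszulExtend_injective

theorem koszulChain_supported {M : ModuleCat.{u} R} {n : ℕ} (x : (koszulComplex r M).X n) :
    KoszulSupported Finset.univ n (koszulChain r M n x) :=
  koszulExtend_supported (R := R) (M := M) x

theorem exists_koszulChain_eq {M : ModuleCat.{u} R} {n : ℕ} {f : Finset σ → M}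
    (hf : KoszulSupported Finset.univ n f) : ∃ x, koszulChain r M n x = f :=
  ⟨koszulRestrict R M n f, koszulExtend_koszulRestrict hf⟩

theorem koszulChain_d {M : ModuleCat.{u} R} {n : ℕ} (x : (koszulComplex r M).X (n + 1)) :
    koszulChain r M n ((koszulComplex r M).d (n + 1) n x) =
      koszulD r (koszulChain r M (n + 1) x) := by
  rw [koszulComplex_d]
  exact koszulExtend_koszulDiff r x

theorem koszulD_koszulChain_zero {M : ModuleCat.{u} R} (x : (koszulComplex r M).X 0) :
    koszulD r (koszulChain r M 0 x) = 0 := by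
  ext S
  refine Finset.sum_eq_zero fun j _ => ?_
  rw [(koszulChain_supported r x).eq_zero fun h => absurd (Finset.card_eq_zero.1 h)
    (Finset.insert_ne_empty j S), smul_zero]

/-- Makes the cycle condition uniform in n: in degree 0 both sides hold trivially. -/
theorem koszulComplex_d_next_eq_zero_iff {M : ModuleCat.{u} R} {n : ℕ}
    (x : (koszulComplex r M).X n) :
    (koszulComplex r M).d n ((ComplexShape.down ℕ).next n) x = 0 ↔
      koszulD r (koszulChain r M n x) = 0 := by
  cases n with
  | zero =>
    rw [(koszulComplex r M).shape _ _ (by simp), koszulD_koszulChain_zero]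
    simp
  | succ n =>
    rw [ChainComplex.next_nat_succ, ← koszulChain_d,
      map_eq_zero_iff _ (koszulChain_injective r M n)]

section Tensor

variable (N : ModuleCat.{u} R)

omit [LinearOrder σ] [Fintype σ] in
theorem koszulExtend_smul {n : ℕ} (f : KoszulIndex σ n → R) (x : N) (S : Finset σ) :
    koszulExtend R N n (fun T => f T • x) S = koszulExtend R R n f S • x := by
  by_cases h : S.card = n <;> simp [koszulExtend, h]

/-- Koszul chains with coefficients in `N` as a tensor product. -/
noncomputable def koszulTensorEquiv (n : ℕ) :
    TensorProduct R (KoszulIndex σ n → R) N ≃ₗ[R] (KoszulIndex σ n → N) :=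
  (TensorProduct.comm R _ _).trans (TensorProduct.piScalarRight R R N (KoszulIndex σ n))

theorem koszulTensorEquiv_tmul {n : ℕ} (f : KoszulIndex σ n → R) (x : N) :
    koszulTensorEquiv N n (f ⊗ₜ[R] x) = fun S => f S • x := by
  ext S
  simp [koszulTensorEquiv]

theorem koszulTensorEquiv_koszulDiff (n : ℕ)
    (z : TensorProduct R (KoszulIndex σ (n + 1) → R) N) :
    koszulTensorEquiv N n ((koszulDiff r R n).rTensor N z) =
      koszulDiff r N n (koszulTensorEquiv N (n + 1) z) := by
  induction z with
  | zero => simp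
  | add z w hz hw => simp only [map_add, hz, hw]
  | tmul f x =>
    rw [LinearMap.rTensor_tmul]
    ext S
    rw [koszulTensorEquiv_tmul, koszulTensorEquiv_tmul]
    change koszulDiff r R n f S • x = _
    rw [koszulDiff_apply, koszulDiff_apply, Finset.sum_smul]
    simp only [koszulExtend_smul, smul_assoc]

/-- The Koszul complex with coefficients in `N` is the tensor product with `N` of the
Koszul complex of the ring. -/
noncomputable def koszulTensorIso :
    (((tensoringRight (ModuleCat.{u} R)).obj N).mapHomologicalComplex (ComplexShape.down ℕ)).obj
      (koszulComplex r (ModuleCat.of R R)) ≅ koszulComplex r N :=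
  HomologicalComplex.Hom.isoOfComponents
    (fun n => (koszulTensorEquiv (σ := σ) N n).toModuleIso) fun i j hij => by
      obtain rfl : j + 1 = i := hij
      rw [koszulComplex_d]
      ext z : 2
      refine (koszulTensorEquiv_koszulDiff r N j z).symm.trans ?_
      change koszulTensorEquiv N j _ = koszulTensorEquiv N j
        (((koszulComplex r (ModuleCat.of R R)).d (j + 1) j ▷ N) z)
      rw [koszulComplex_d]
      rfl

/-- Through this, the inclusion of I^(s+1) in I^s leaves the underlying R-valued chains unchanged.
-/
theorem koszulTensorIso_naturality {N N' : ModuleCat.{u} R} (f : N ⟶ N') (n : ℕ)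
    (z : ((((tensoringRight (ModuleCat.{u} R)).obj N).mapHomologicalComplex
      (ComplexShape.down ℕ)).obj (koszulComplex r (ModuleCat.of R R))).X n) :
    koszulChain r N' n ((koszulTensorIso r N').hom.f n
      (((NatTrans.mapHomologicalComplex ((tensoringRight (ModuleCat.{u} R)).map f)
        (ComplexShape.down ℕ)).app (koszulComplex r (ModuleCat.of R R))).f n z)) =
      fun S => f (koszulChain r N n ((koszulTensorIso r N).hom.f n z) S) := by
  have key : ∀ z : TensorProduct R (KoszulIndex σ n → R) N,
      koszulTensorEquiv N' n (f.hom.lTensor (KoszulIndex σ n → R) z) =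
        fun S => f.hom (koszulTensorEquiv N n z S) := by
    intro z
    induction z with
    | zero => ext S; simp
    | add z w hz hw => ext S; simp [hz, hw]
    | tmul g x => ext S; simp [koszulTensorEquiv]
  ext S
  change koszulExtend R N' n (koszulTensorEquiv N' n (f.hom.lTensor (KoszulIndex σ n → R) z)) S =
    f.hom (koszulExtend R N n (koszulTensorEquiv N n z) S)
  refine (congrFun (congrArg (koszulExtend R N' n) (key z)) S).trans ?_
  by_cases h : S.card = n <;> simp [koszulExtend, h]

end Tensor

section Resolution

variable {r}

/-- The augmentation of the Koszul complex. -/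
noncomputable def koszulAugmentation (r : σ → R) : (koszulComplex r (ModuleCat.of R R)).X 0 ⟶
    ModuleCat.of R (R ⧸ Ideal.span (Set.range r)) :=
  ModuleCat.ofHom ((Algebra.linearMap R _) ∘ₗ
    (LinearMap.proj (R := R) (φ := fun _ : Finset σ => R) ∅) ∘ₗ
      koszulChain r (ModuleCat.of R R) 0)

theorem koszulAugmentation_eq_zero_iff (r : σ → R)
    (x : (koszulComplex r (ModuleCat.of R R)).X 0) :
    koszulAugmentation r x = 0 ↔
      (koszulChain r (ModuleCat.of R R) 0 x ∅ : R) ∈ Ideal.span (Set.range r) :=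
  Ideal.Quotient.eq_zero_iff_mem

theorem d_koszulAugmentation (r : σ → R) :
    (koszulComplex r (ModuleCat.of R R)).d 1 0 ≫ koszulAugmentation r = 0 := by
  ext x
  refine (koszulAugmentation_eq_zero_iff r _).2 ?_
  have h := koszulD_empty_mem r (koszulChain_supported r x)
  rw [Finset.coe_univ, Set.image_univ] at h
  exact Set.mem_of_eq_of_mem (congrFun (koszulChain_d r x) ∅) h

theorem IsRegularFamily.koszulComplex_exact (hr : IsRegularFamily r) {n : ℕ}
    {x : (koszulComplex r (ModuleCat.of R R)).X n}
    (hx : koszulD r (koszulChain r (ModuleCat.of R R) n x) = 0)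
    (hx0 : (koszulChain r (ModuleCat.of R R) n x ∅ : R) ∈ Ideal.span (Set.range r)) :
    ∃ y, (koszulComplex r (ModuleCat.of R R)).d (n + 1) n y = x := by
  obtain ⟨g, hg, hgx⟩ := hr.koszul_exact (koszulChain_supported r x) hx hx0
  obtain ⟨y, rfl⟩ := exists_koszulChain_eq r (M := ModuleCat.of R R) hg
  exact ⟨y, koszulChain_injective r _ _ ((koszulChain_d r y).trans hgx)⟩

theorem IsRegularFamily.quasiIso (hr : IsRegularFamily r) :
    QuasiIso (((koszulComplex r (ModuleCat.of R R)).toSingle₀Equiv _).symm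
      ⟨koszulAugmentation r, d_koszulAugmentation r⟩) := by
  refine ⟨fun n => ?_⟩
  cases n with
  | zero =>
    -- In degree 0 the claim is that the augmentation is surjective with kernel the boundaries; in
    -- positive degrees it is acyclicity.
    rw [ChainComplex.quasiIsoAt₀_iff, ShortComplex.quasiIso_iff_of_zeros']
    · refine ⟨(ShortComplex.ShortExact.moduleCat_exact_iff_function_exact _).2 ?_,
        (ModuleCat.epi_iff_surjective _).2 ?_⟩
      · intro x
        change (HomologicalComplex.Hom.f (((koszulComplex r
          (ModuleCat.of R R)).toSingle₀Equiv _).symm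
            ⟨koszulAugmentation r, d_koszulAugmentation r⟩) 0) x = 0 ↔
          ∃ y, (koszulComplex r (ModuleCat.of R R)).d 1 0 y = x
        rw [ChainComplex.toSingle₀Equiv_symm_apply_f_zero]
        constructor
        · intro hx
          exact hr.koszulComplex_exact (koszulD_koszulChain_zero r x)
            ((koszulAugmentation_eq_zero_iff r x).1 hx)
        · rintro ⟨y, rfl⟩
          exact congrArg (fun φ => φ.hom y) (d_koszulAugmentation r)
      · change Function.Surjective (HomologicalComplex.Hom.f (((koszulComplex r
          (ModuleCat.of R R)).toSingle₀Equiv _).symm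
            ⟨koszulAugmentation r, d_koszulAugmentation r⟩) 0)
        rw [ChainComplex.toSingle₀Equiv_symm_apply_f_zero]
        intro y
        obtain ⟨y, rfl⟩ := Ideal.Quotient.mk_surjective (y : R ⧸ Ideal.span (Set.range r))
        refine ⟨(fun _ => y : KoszulIndex σ 0 → R), ?_⟩
        rfl
    · exact (koszulComplex r (ModuleCat.of R R)).shape 0 0 (by simp)
    · exact HomologicalComplex.single_obj_d (ComplexShape.down ℕ) 0 _ 1 0
    · exact HomologicalComplex.single_obj_d (ComplexShape.down ℕ) 0 _ 0 0
  | succ n =>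
    rw [quasiIsoAt_iff_exactAt' _ _ (ChainComplex.exactAt_succ_single_obj _ _),
      HomologicalComplex.exactAt_iff' _ (n + 2) (n + 1) n (by simp) (by simp),
      ShortComplex.ShortExact.moduleCat_exact_iff_function_exact]
    intro (x : (koszulComplex r (ModuleCat.of R R)).X (n + 1))
    change (koszulComplex r (ModuleCat.of R R)).d (n + 1) n x = 0 ↔
      ∃ y, (koszulComplex r (ModuleCat.of R R)).d (n + 2) (n + 1) y = x
    constructor
    · intro hx
      refine hr.koszulComplex_exact ?_ ?_
      · rw [← koszulChain_d, hx, map_zero]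
      · rw [(koszulChain_supported r x).eq_zero fun h => absurd h (by simp)]
        exact zero_mem _
    · rintro ⟨y, rfl⟩
      exact congrArg (fun φ => φ.hom y)
        ((koszulComplex r (ModuleCat.of R R)).d_comp_d (n + 2) (n + 1) n)

/-- The Koszul resolution of the quotient by a regular sequence. -/
noncomputable def IsRegularFamily.koszulResolution (hr : IsRegularFamily r) :
    ProjectiveResolution (ModuleCat.of R (R ⧸ Ideal.span (Set.range r))) where
  complex := koszulComplex r (ModuleCat.of R R)
  projective n := (IsProjective.iff_projective _).1
    (inferInstanceAs (Module.Projective R (KoszulIndex σ n → R)))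
  π := ((koszulComplex r (ModuleCat.of R R)).toSingle₀Equiv _).symm
    ⟨koszulAugmentation r, d_koszulAugmentation r⟩
  quasiIso := hr.quasiIso

end Resolution

end KoszulComplex

/-! ### A monomial basis of the chains fixed by hd. -/

section MonomialChains

open MvPolynomial

variable {σ : Type} [LinearOrder σ] {R : Type u} [CommRing R]

/-- The pairs of an exterior monomial of degree `n + 1` and a monomial of degree `t` all of whose
variables come weakly after the first one of the exterior monomial. They index a basis of the
range of the homotopy of the Koszul complex of the variables. -/
abbrev LeadingPair (σ : Type) [LinearOrder σ] (n t : ℕ) : Type :=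
  {v : Finset σ × (σ →₀ ℕ) //
    v.1.card = n + 1 ∧ v.2.degree = t ∧ ∀ k, v.2 k ≠ 0 → ∃ p ∈ v.1, p ≤ k}

variable {n t : ℕ}

/-- The Koszul chain of polynomials with given coefficients at the leading pairs. -/
noncomputable def monomialChain :
    (LeadingPair σ n t →₀ R) →ₗ[R] (Finset σ → MvPolynomial σ R) :=
  Finsupp.linearCombination R fun v => Pi.single v.1.1 (monomial v.1.2 1)

open Classical in
theorem coeff_monomialChain (c : LeadingPair σ n t →₀ R) (S : Finset σ) (a : σ →₀ ℕ) :
    coeff a (monomialChain c S) =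
      if h : S.card = n + 1 ∧ a.degree = t ∧ ∀ k, a k ≠ 0 → ∃ p ∈ S, p ≤ k
      then c ⟨(S, a), h⟩ else 0 := by
  induction c using Finsupp.induction_linear with
  | zero => simp
  | add c d hc hd =>
    rw [map_add, Pi.add_apply, coeff_add, hc, hd]
    split_ifs <;> simp
  | single v x =>
    obtain ⟨⟨S', a'⟩, hv⟩ := v
    rw [monomialChain, Finsupp.linearCombination_single, Pi.smul_apply, coeff_smul]
    by_cases hS : S = S'
    · subst hS
      rw [Pi.single_eq_same, coeff_monomial]
      by_cases ha : a' = a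
      · subst ha
        rw [dif_pos hv]
        simp
      · rw [if_neg ha, smul_zero]
        split_ifs
        · rw [Finsupp.single_eq_of_ne]
          intro h
          simp only [Subtype.mk.injEq, Prod.mk.injEq, true_and] at h
          exact ha h.symm
        · rfl
    · rw [Pi.single_eq_of_ne hS, coeff_zero, smul_zero]
      split_ifs
      · rw [Finsupp.single_eq_of_ne]
        intro h
        simp only [Subtype.mk.injEq, Prod.mk.injEq] at h
        exact hS h.1
      · rfl

theorem monomialChain_support {c : LeadingPair σ n t →₀ R} {S : Finset σ} {a : σ →₀ ℕ}
    (h : coeff a (monomialChain c S) ≠ 0) :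
    S.card = n + 1 ∧ a.degree = t ∧ ∀ k, a k ≠ 0 → ∃ p ∈ S, p ≤ k := by
  rw [coeff_monomialChain] at h
  by_contra h'
  exact h (dif_neg h')

theorem coeff_monomialChain_leadingPair (c : LeadingPair σ n t →₀ R) (v : LeadingPair σ n t) :
    coeff v.1.2 (monomialChain c v.1.1) = c v := by
  rw [coeff_monomialChain, dif_pos v.2]

theorem monomialChain_isHomogeneous (c : LeadingPair σ n t →₀ R) (S : Finset σ) :
    (monomialChain c S).IsHomogeneous t := by
  intro a ha
  rw [← (monomialChain_support ha).2.1, Finsupp.degree_eq_weight_one]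
  rfl

/-- A nonzero value would need a monomial divisible by a variable p preceding all of S, which the
leading condition forbids. The homotopy identity then gives hdF = F on these chains. -/
theorem koszulHomotopy_monomialChain (c : LeadingPair σ n t →₀ R) :
    koszulHomotopy (monomialChain c) = 0 := by
  ext S a
  rw [Pi.zero_apply, coeff_zero]
  rcases S.eq_empty_or_nonempty with rfl | hS
  · rw [koszulHomotopy, dif_neg Finset.not_nonempty_empty, coeff_zero]
  · obtain ⟨p, S, rfl, hp⟩ := exists_eq_insert_min hS
    rw [koszulHomotopy_insert _ hp, coeff_divFirst]
    split_ifs with h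
    · by_contra hne
      obtain ⟨q, hq, hqp⟩ := (monomialChain_support hne).2.2 p (by simp)
      exact absurd (hp q hq) (not_lt.2 hqp)
    · rfl

variable [Fintype σ]

theorem monomialChain_supported (c : LeadingPair σ n t →₀ R) :
    KoszulSupported Finset.univ (n + 1) (monomialChain c) := by
  intro S hS
  obtain ⟨a, ha⟩ := ne_zero_iff.1 hS
  exact ⟨(monomialChain_support ha).1, Finset.subset_univ S⟩

theorem koszulHomotopy_koszulD_monomialChain (c : LeadingPair σ n t →₀ R) :
    koszulHomotopy (koszulD (R := MvPolynomial σ R) X (monomialChain c)) = monomialChain c := by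
  ext1 S
  have h := koszulD_koszulHomotopy_add (monomialChain c) S fun _ => by
    rw [(monomialChain_supported c).eq_zero fun h => absurd h (by simp), coeff_zero]
  rwa [koszulHomotopy_monomialChain, map_zero, Pi.zero_apply, zero_add] at h

theorem exists_monomialChain_eq {F : Finset σ → MvPolynomial σ R}
    (hF : KoszulSupported Finset.univ (n + 1) F) (hFt : ∀ S, (F S).IsHomogeneous t)
    (hFh : koszulHomotopy (koszulD (R := MvPolynomial σ R) X F) = F) :
    ∃ c : LeadingPair σ n t →₀ R, monomialChain c = F := by
  classical
  have hfin : (Function.support fun v : LeadingPair σ n t => coeff v.1.2 (F v.1.1)).Finite := by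
    refine ((Finset.univ.sigma fun S => (F S).support).finite_toSet.preimage
      (f := fun v : LeadingPair σ n t => (⟨v.1.1, v.1.2⟩ : (_ : Finset σ) × (σ →₀ ℕ))) ?_).subset ?_
    · intro v _ w _ h
      simp only [Sigma.mk.injEq, heq_eq_eq] at h
      exact Subtype.ext (Prod.ext h.1 h.2)
    · intro v hv
      simpa using hv
  refine ⟨Finsupp.ofSupportFinite _ hfin, ?_⟩
  ext S a
  rw [coeff_monomialChain]
  split_ifs with h
  · rfl
  · symm
    by_contra hne
    refine h ⟨(hF S fun h0 => hne (by rw [h0, coeff_zero])).1, ?_, fun k hk => ?_⟩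
    · rw [← hFt S hne, Finsupp.degree_eq_weight_one]
      rfl
    · have hS : S.Nonempty := by
        rw [← Finset.card_pos, (hF S fun h0 => hne (by rw [h0, coeff_zero])).1]
        exact Nat.succ_pos n
      obtain ⟨p, S, rfl, hp⟩ := exists_eq_insert_min hS
      -- Values of the homotopy involve no variable before the first one of the exterior monomial,
      -- which is the leading condition.
      rw [← hFh, koszulHomotopy_insert _ hp, coeff_divFirst] at hne
      refine ⟨p, Finset.mem_insert_self p S, not_lt.1 fun hkp => ?_⟩
      exact hne (if_neg fun h' => hk (h' k hkp))

/-- The boundary of the value at `r` of a chain of polynomials with coefficients at the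
leading pairs. -/
noncomputable def monomialBoundary (r : σ → R) : (LeadingPair σ n t →₀ R) →ₗ[R] (Finset σ → R) :=
  koszulD r ∘ₗ (aeval r).toLinearMap.compLeft (Finset σ) ∘ₗ monomialChain

theorem monomialBoundary_apply (r : σ → R) (c : LeadingPair σ n t →₀ R) :
    monomialBoundary r c = koszulD r fun S => eval r (monomialChain c S) := by
  refine congrArg (koszulD r) (funext fun S => ?_)
  exact congrFun (congrArg DFunLike.coe (coe_aeval_eq_eval r)) _

theorem eval_monomialChain_supported (r : σ → R) (c : LeadingPair σ n t →₀ R) :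
    KoszulSupported Finset.univ (n + 1) fun S => eval r (monomialChain c S) := fun S hS =>
  monomialChain_supported c S fun h => hS (by simp [h])

theorem monomialBoundary_mem (r : σ → R) (c : LeadingPair σ n t →₀ R) (S : Finset σ) :
    monomialBoundary r c S ∈ Ideal.span (Set.range r) ^ (t + 1) := by
  rw [monomialBoundary_apply]
  exact koszulD_mem_pow_succ r (fun S => (Ideal.mem_span_pow_iff_exists_isHomogeneous r _).2
    ⟨_, monomialChain_isHomogeneous c S, rfl⟩) S

theorem IsRegularFamily.exists_monomialBoundary_eq {r : σ → R} (hr : IsRegularFamily r)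
    {z : Finset σ → R} (hz : KoszulSupported Finset.univ n z) (hdz : koszulD r z = 0)
    (hzI : ∀ S, z S ∈ Ideal.span (Set.range r) ^ (t + 1)) :
    ∃ c : LeadingPair σ n t →₀ R, monomialBoundary r c = z := by
  obtain ⟨w, hw, hwz, hwI⟩ := hr.exists_koszulD_eq hz hdz hzI
  obtain ⟨F, hF, hFt, hFh, hFw⟩ := exists_koszulHomotopy_eq r hw hwI
  obtain ⟨c, rfl⟩ := exists_monomialChain_eq hF hFt hFh
  exact ⟨c, by rw [monomialBoundary_apply, hFw, hwz]⟩

/-- If y has coefficients in I^(t+1), its boundary lies over I^(t+2), and quasi-regularity together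
with F = hdF forces c into I. Conversely the value of the chain itself serves as y. -/
theorem IsRegularFamily.monomialBoundary_eq_koszulD_iff {r : σ → R} (hr : IsRegularFamily r)
    (c : LeadingPair σ n t →₀ R) :
    (∃ y, KoszulSupported Finset.univ (n + 1) y ∧
      (∀ S, y S ∈ Ideal.span (Set.range r) ^ (t + 1)) ∧ koszulD r y = monomialBoundary r c) ↔
        ∀ v, c v ∈ Ideal.span (Set.range r) := by
  constructor
  · rintro ⟨y, _, hyI, hyc⟩ v
    rw [← coeff_monomialChain_leadingPair c v]
    refine mem_map_C_iff.1 ((hr.isQuasiRegularIn (t + 1)).mem_map_C_of_koszulD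
      (monomialChain_isHomogeneous c) (koszulHomotopy_koszulD_monomialChain c) (fun S => ?_) _) _
    rw [← monomialBoundary_apply, ← hyc]
    exact koszulD_mem_pow_succ r hyI S
  · intro hc
    refine ⟨_, eval_monomialChain_supported r c, fun S => eval_mem_pow_succ r
      (monomialChain_isHomogeneous c S) (mem_map_C_iff.2 fun a => ?_),
      (monomialBoundary_apply r c).symm⟩
    rw [coeff_monomialChain]
    split_ifs
    · exact hc _
    · exact zero_mem _

end MonomialChains

/-! ### Koszul chains with coefficients in an ideal as R-valued chains. -/

section IdealChains

variable {σ : Type} [LinearOrder σ] [Fintype σ] {R : Type u} [CommRing R] (r : σ → R)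
  (J : Ideal R) {n : ℕ}

/-- A Koszul chain with coefficients in an ideal as a Koszul chain with coefficients in the
ring. -/
noncomputable def idealChain (n : ℕ) :
    (koszulComplex r (ModuleCat.of R J)).X n →ₗ[R] (Finset σ → R) :=
  J.subtype.compLeft (Finset σ) ∘ₗ koszulChain r (ModuleCat.of R J) n

variable {J}

theorem idealChain_injective : Function.Injective (idealChain r J n) := by
  intro x y h
  refine koszulChain_injective r _ n (funext fun S => Subtype.ext ?_)
  exact congrFun h S

theorem idealChain_supported (x : (koszulComplex r (ModuleCat.of R J)).X n) :
    KoszulSupported Finset.univ n (idealChain r J n x) := fun S hS =>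
  koszulChain_supported r x S fun h => hS (congrArg Subtype.val h)

theorem idealChain_mem (x : (koszulComplex r (ModuleCat.of R J)).X n) (S : Finset σ) :
    idealChain r J n x S ∈ J :=
  (koszulChain r (ModuleCat.of R J) n x S : J).2

theorem koszulD_idealChain (x : (koszulComplex r (ModuleCat.of R J)).X n) :
    koszulD r (idealChain r J n x) =
      J.subtype.compLeft (Finset σ) (koszulD r (koszulChain r (ModuleCat.of R J) n x)) := by
  ext S
  have h : ∀ f : Finset σ → J, ((koszulD r f S : J) : R) = koszulD r (fun S => (f S : R)) S := by
    intro f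
    rw [koszulD_apply, koszulD_apply, AddSubmonoidClass.coe_finsetSum]
    rfl
  exact (h (koszulChain r (ModuleCat.of R J) n x)).symm

theorem idealChain_d (x : (koszulComplex r (ModuleCat.of R J)).X (n + 1)) :
    idealChain r J n ((koszulComplex r (ModuleCat.of R J)).d (n + 1) n x) =
      koszulD r (idealChain r J (n + 1) x) := by
  rw [koszulD_idealChain]
  exact congrArg (J.subtype.compLeft (Finset σ)) (koszulChain_d r x)

theorem koszulComplex_d_next_eq_zero_iff_idealChain
    (x : (koszulComplex r (ModuleCat.of R J)).X n) :
    (koszulComplex r (ModuleCat.of R J)).d n ((ComplexShape.down ℕ).next n) x = 0 ↔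
      koszulD r (idealChain r J n x) = 0 := by
  rw [koszulComplex_d_next_eq_zero_iff, koszulD_idealChain]
  refine (map_eq_zero_iff _ ?_).symm
  intro f g h
  exact funext fun S => Subtype.ext (congrFun h S)

/-- The Koszul chain of degree `n` with given coefficients in an ideal. -/
noncomputable def idealChainMk {A : Type*} [AddCommGroup A] [Module R A]
    (B : A →ₗ[R] (Finset σ → R))
    (hB : ∀ c S, B c S ∈ J) (n : ℕ) : A →ₗ[R] (koszulComplex r (ModuleCat.of R J)).X n :=
  koszulRestrict R J n ∘ₗ LinearMap.pi fun S =>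
    LinearMap.codRestrict J (LinearMap.proj S ∘ₗ B) fun c => hB c S

theorem idealChain_idealChainMk {A : Type*} [AddCommGroup A] [Module R A]
    (B : A →ₗ[R] (Finset σ → R)) (hB : ∀ c S, B c S ∈ J) {c : A}
    (hc : KoszulSupported Finset.univ n (B c)) :
    idealChain r J n (idealChainMk r B hB n c) = B c := by
  have h : KoszulSupported Finset.univ n fun S => (⟨B c S, hB c S⟩ : J) := fun S hS =>
    hc S fun h => hS (Subtype.ext h)
  ext S
  exact congrArg Subtype.val (congrFun (koszulExtend_koszulRestrict (R := R) h) S)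

theorem exists_idealChain_eq {f : Finset σ → R} (hf : KoszulSupported Finset.univ n f)
    (hfJ : ∀ S, f S ∈ J) : ∃ x, idealChain r J n x = f := by
  have h := idealChain_idealChainMk r (LinearMap.toSpanSingleton R (Finset σ → R) f)
    (fun c S => J.smul_mem c (hfJ S)) (c := 1) (n := n) (by simpa using hf)
  exact ⟨_, h.trans (one_smul R f)⟩

end IdealChains

/-! ### Tor of the powers of I. -/

namespace RegularTor

variable {σ : Type} [LinearOrder σ] [Fintype σ] {R : Type u} [CommRing R] {r : σ → R}

/-- `Tor_n^R(R/I, N)` as the homology of the Koszul complex with coefficients in `N`. -/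
noncomputable def torKoszulEquiv (hr : IsRegularFamily r) (n : ℕ) (N : ModuleCat.{u} R) :
    TorQuot (Ideal.span (Set.range r)) n N ≃ₗ[R] (koszulComplex r N).homology n :=
  (torEquiv hr.koszulResolution n N).trans
    ((HomologicalComplex.homologyFunctor _ _ n).mapIso (koszulTensorIso r N)).toLinearEquiv

/-- Restates freeness of Tor purely in terms of R-valued chains with coefficients in J, removing
categories and subtypes. -/
theorem free_torQuot_of_koszul (hr : IsRegularFamily r) {J : Ideal R} {n : ℕ} {V : Type}
    (B : (V →₀ R) →ₗ[R] (Finset σ → R)) (hB : ∀ c, KoszulSupported Finset.univ n (B c))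
    (hBJ : ∀ c S, B c S ∈ J) (hdB : ∀ c, koszulD r (B c) = 0)
    (hspan : ∀ z, KoszulSupported Finset.univ n z → koszulD r z = 0 → (∀ S, z S ∈ J) →
      ∃ c y, KoszulSupported Finset.univ (n + 1) y ∧ (∀ S, y S ∈ J) ∧ z = B c + koszulD r y)
    (hker : ∀ c, (∃ y, KoszulSupported Finset.univ (n + 1) y ∧ (∀ S, y S ∈ J) ∧
      koszulD r y = B c) ↔ ∀ v, c v ∈ Ideal.span (Set.range r)) :
    Module.Free (R ⧸ Ideal.span (Set.range r))
      (TorQuot (Ideal.span (Set.range r)) n (ModuleCat.of R J)) := by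
  have hψ : ∀ c, idealChain r J n (idealChainMk r B hBJ n c) = B c := fun c =>
    idealChain_idealChainMk r B hBJ (hB c)
  refine Module.Free.of_homology (torKoszulEquiv hr n _) (idealChainMk r B hBJ n) ?_ ?_ ?_
  · intro c
    rw [koszulComplex_d_next_eq_zero_iff_idealChain, hψ, hdB]
  · intro x hx
    obtain ⟨c, y, hy, hyJ, hxy⟩ := hspan _ (idealChain_supported r x)
      ((koszulComplex_d_next_eq_zero_iff_idealChain r x).1 hx) (idealChain_mem r x)
    obtain ⟨y, rfl⟩ := exists_idealChain_eq r hy hyJ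
    refine ⟨c, y, idealChain_injective r ?_⟩
    rw [map_add, hψ, idealChain_d, hxy]
  · intro c
    rw [← hker]
    constructor
    · rintro ⟨y, hy⟩
      refine ⟨_, idealChain_supported r y, idealChain_mem r y, ?_⟩
      rw [← idealChain_d, hy, hψ]
    · rintro ⟨y, hy, hyJ, hyc⟩
      obtain ⟨y, rfl⟩ := exists_idealChain_eq r hy hyJ
      refine ⟨y, idealChain_injective r ?_⟩
      rw [idealChain_d, hyc, hψ]

theorem free_torQuot_pow (hr : IsRegularFamily r) (n s : ℕ) :
    Module.Free (R ⧸ Ideal.span (Set.range r)) (TorQuot (Ideal.span (Set.range r)) n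
      (ModuleCat.of R ↥(Ideal.span (Set.range r) ^ s))) := by
  cases s with
  | succ t =>
    refine free_torQuot_of_koszul hr (V := LeadingPair σ n t) (monomialBoundary r) (fun c => ?_)
      (monomialBoundary_mem r) (fun c => ?_) (fun z hz hdz hzI => ?_)
      hr.monomialBoundary_eq_koszulD_iff
    · rw [monomialBoundary_apply]
      exact (eval_monomialChain_supported r c).koszulD r
    · rw [monomialBoundary_apply, koszulD_koszulD]
    · obtain ⟨c, rfl⟩ := hr.exists_monomialBoundary_eq hz hdz hzI
      exact ⟨c, 0, fun S hS => absurd rfl hS, fun S => zero_mem _, by rw [map_zero, add_zero]⟩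
  | zero =>
    have htop : ∀ x, x ∈ Ideal.span (Set.range r) ^ 0 := fun x => by simp
    cases n with
    | succ n =>
      -- Tor_(n+1)(R/I, R) vanishes by acyclicity: the basis is empty.
      refine free_torQuot_of_koszul hr (V := Empty) 0 (fun c S hS => absurd rfl hS)
        (fun c S => htop _) (fun c => by simp) (fun z hz hdz _ => ?_) (fun c => ?_)
      · obtain ⟨y, hy, rfl⟩ := hr.koszul_exact hz hdz (by
          rw [hz.eq_zero fun h => absurd h (by simp)]
          exact zero_mem _)
        exact ⟨0, y, hy, fun S => htop _, by simp⟩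
      · exact ⟨fun _ v => v.elim, fun _ => ⟨0, fun S hS => absurd rfl hS, fun S => htop _,
          by simp⟩⟩
    | zero =>
      have hB : ∀ x : R, KoszulSupported Finset.univ 0 (Pi.single ∅ x : Finset σ → R) := by
        intro x S hS
        refine ⟨?_, Finset.subset_univ S⟩
        by_contra h
        have h' : S ≠ ∅ := fun h' => h (Finset.card_eq_zero.2 h')
        exact hS (by simp [h'])
      have hd : ∀ z : Finset σ → R, KoszulSupported Finset.univ 0 z → koszulD r z = 0 := by
        intro z hz
        ext S
        refine Finset.sum_eq_zero fun j _ => ?_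
        rw [hz.eq_zero fun h => absurd (Finset.card_eq_zero.1 h) (Finset.insert_ne_empty j S),
          smul_zero]
      -- Tor_0(R/I, R) is R/I, with the class of 1 at ∅ as basis.
      refine free_torQuot_of_koszul hr (V := Unit)
        (LinearMap.single R (fun _ : Finset σ => R) ∅ ∘ₗ Finsupp.lapply ()) (fun c => hB _)
        (fun c S => htop _) (fun c => hd _ (hB _)) (fun z hz _ _ => ?_) (fun c => ?_)
      · refine ⟨Finsupp.single () (z ∅), 0, fun S hS => absurd rfl hS, fun S => htop _, ?_⟩
        ext S
        by_cases hS : S = ∅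
        · subst hS
          simp
        · rw [hz.eq_zero fun h => absurd (Finset.card_eq_zero.1 h) hS]
          simp [hS]
      · constructor
        · rintro ⟨y, hy, _, hyc⟩ v
          have h := koszulD_empty_mem r hy
          rw [hyc] at h
          simpa using h
        · intro hc
          obtain ⟨y, hy, hyc⟩ := exists_koszulD_eq_single_empty r Finset.univ
            (x := c ()) (by simpa using hc ())
          exact ⟨y, hy, fun S => htop _, hyc⟩

theorem torObjMap_inclusion_eq_zero (hr : IsRegularFamily r) (n s : ℕ) :
    torObjMap n (ModuleCat.of R (R ⧸ Ideal.span (Set.range r)))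
      (powShortComplex (Ideal.span (Set.range r)) s).f = 0 := by
  set I := Ideal.span (Set.range r)
  suffices h : HomologicalComplex.homologyMap ((NatTrans.mapHomologicalComplex
      ((tensoringRight (ModuleCat.{u} R)).map (powShortComplex I s).f)
        (ComplexShape.down ℕ)).app hr.koszulResolution.complex) n = 0 by
    refine ModuleCat.hom_ext (LinearMap.ext fun x => ?_)
    refine (torEquiv hr.koszulResolution n _).injective ?_
    refine (torEquiv_torObjMap hr.koszulResolution n (powShortComplex I s).f x).trans ?_
    rw [h]
    exact (map_zero (torEquiv hr.koszulResolution n _)).symm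
  refine homologyMap_eq_zero _ fun z hz => ?_
  let e := koszulTensorIso r (ModuleCat.of R ↥(I ^ (s + 1)))
  let e' := koszulTensorIso r (ModuleCat.of R ↥(I ^ s))
  have h1 : koszulD r (idealChain r (I ^ (s + 1)) n (e.hom.f n z)) = 0 := by
    rw [← koszulComplex_d_next_eq_zero_iff_idealChain]
    have hc := congrArg (fun φ => φ.hom z) (e.hom.comm n ((ComplexShape.down ℕ).next n))
    refine hc.trans ((congrArg (e.hom.f ((ComplexShape.down ℕ).next n)).hom hz).trans ?_)
    exact map_zero (e.hom.f ((ComplexShape.down ℕ).next n)).hom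
  -- The heart of the vanishing: a cycle over I^(s+1) bounds over I^s.
  obtain ⟨w, hw, hwz, hwI⟩ := hr.exists_koszulD_eq (idealChain_supported r _) h1
    (idealChain_mem r _)
  obtain ⟨y, rfl⟩ := exists_idealChain_eq r hw hwI
  obtain ⟨y, rfl⟩ : ∃ y', e'.hom.f (n + 1) y' = y :=
    ⟨e'.inv.f (n + 1) y, congrArg (fun φ => (φ.f (n + 1)).hom y) e'.inv_hom_id⟩
  refine ⟨y, ?_⟩
  have hinj : Function.Injective (e'.hom.f n) :=
    (ModuleCat.mono_iff_injective _).1 inferInstance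
  refine hinj (idealChain_injective r ?_)
  refine ((congrArg (fun φ => idealChain r (I ^ s) n (φ.hom y)) (e'.hom.comm (n + 1) n)).symm.trans
    (idealChain_d r _)).trans (hwz.trans ?_)
  ext S
  exact (congrArg Subtype.val
    (congrFun (koszulTensorIso_naturality r (powShortComplex I s).f n z) S)).symm

/-- The ideal of the first i list entries is the span of the values on indices below i, so the two
forms of regularity agree. -/
theorem isRegularFamily_get {rs : List R} (hrs : RingTheory.Sequence.IsWeaklyRegular R rs) :
    IsRegularFamily rs.get := by
  intro i x hx
  have hset : Ideal.ofList (rs.take i) • (⊤ : Submodule R R) =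
      Ideal.span (rs.get '' Set.Iio i) := by
    rw [smul_eq_mul, Ideal.mul_top, Ideal.ofList]
    congr 1
    ext y
    simp only [List.mem_take_iff_getElem, Set.mem_ofPred_eq, Set.mem_image, Set.mem_Iio,
      List.get_eq_getElem]
    constructor
    · rintro ⟨j, hj, rfl⟩
      exact ⟨⟨j, by omega⟩, Fin.lt_def.2 (by change j < i; omega), rfl⟩
    · rintro ⟨j, hj, rfl⟩
      exact ⟨j, by have := Fin.lt_def.1 hj; omega, rfl⟩
  have h := hrs.regular_mod_prev i i.2
  rw [← hset] at hx ⊢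
  rw [← Submodule.Quotient.mk_eq_zero]
  refine h ?_
  change rs[i] • Submodule.Quotient.mk x = rs[i] • 0
  rw [smul_zero, ← Submodule.Quotient.mk_smul, Submodule.Quotient.mk_eq_zero]
  exact hx

end RegularTor

open RegularTor in
theorem theorem1 {R : Type u} [CommRing R] (rs : List R)
    (hrs : RingTheory.Sequence.IsWeaklyRegular R rs) (I : Ideal R) (hI : I = Ideal.ofList rs)
    (s : ℕ) :
    (∀ n : ℕ,
      Module.Free (R ⧸ I) (TorQuot I n (ModuleCat.of R ↥(I ^ s))) ∧
      Module.Free (R ⧸ I) (TorQuot I n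
        (ModuleCat.of R (↥(I ^ s) ⧸ Submodule.submoduleOf (I ^ (s + 1)) (I ^ s)))) ∧
      Module.Free (R ⧸ I) (TorQuot I n (ModuleCat.of R ↥(I ^ (s + 1))))) ∧
    Function.Bijective (torMap I 0 (powShortComplex I s).g) ∧
    (∀ n : ℕ,
      Function.Injective (torMap I (n + 1) (powShortComplex I s).g) ∧
      Function.Exact (torMap I (n + 1) (powShortComplex I s).g)
        (torδ I n (powShortComplex_shortExact I s)) ∧
      Function.Surjective (torδ I n (powShortComplex_shortExact I s))) := by
  obtain rfl : I = Ideal.span (Set.range rs.get) := by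
    rw [hI, Ideal.ofList, Set.range_list_get]
  have hr := isRegularFamily_get hrs
  set I := Ideal.span (Set.range rs.get)
  let M : ModuleCat.{u} R := ModuleCat.of R (R ⧸ I)
  have hzero : ∀ n, torObjMap n M (powShortComplex I s).f = 0 := fun n =>
    torObjMap_inclusion_eq_zero hr n s
  have hinj : ∀ n, Function.Injective (torMap I n (powShortComplex I s).g) := by
    intro n
    refine (injective_iff_map_eq_zero _).2 fun x hx => ?_
    obtain ⟨y, rfl⟩ := (torObj_exact₂ M (powShortComplex_shortExact I s) n x).1 hx
    exact congrArg (fun φ => φ.hom y) (hzero n)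
  have hsurj : ∀ n, Function.Surjective (torδ I n (powShortComplex_shortExact I s)) := fun n x =>
    (torObj_exact₁ M (powShortComplex_shortExact I s) n x).1
      (congrArg (fun φ => φ.hom x) (hzero n))
  have hexact : ∀ n, Function.Exact (torMap I (n + 1) (powShortComplex I s).g)
      (torδ I n (powShortComplex_shortExact I s)) := fun n =>
    torObj_exact₃ M (powShortComplex_shortExact I s) n
  have hbij : Function.Bijective (torMap I 0 (powShortComplex I s).g) :=
    ⟨hinj 0, torObjMap_zero_surjective M (powShortComplex_shortExact I s)⟩
  refine ⟨fun n => ⟨free_torQuot_pow hr n s, ?_, free_torQuot_pow hr n (s + 1)⟩, hbij,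
    fun n => ⟨hinj (n + 1), hexact n, hsurj n⟩⟩
  -- For n = 0 freeness passes along the isomorphism `hbij`; for n + 1 the short exact sequence has
  -- free ends.
  cases n with
  | zero =>
    have : Module.Free (R ⧸ I) (TorQuot I 0 (powShortComplex I s).X₂) :=
      free_torQuot_pow hr 0 s
    exact Module.Free.of_equiv (LinearEquiv.ofBijective _ hbij)
  | succ n =>
    have : Module.Free (R ⧸ I) (TorQuot I (n + 1) (powShortComplex I s).X₂) :=
      free_torQuot_pow hr (n + 1) s
    have : Module.Free (R ⧸ I) (TorQuot I n (powShortComplex I s).X₁) :=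
      free_torQuot_pow hr n (s + 1)
    exact Module.Free.of_exact (hinj (n + 1)) (hexact n) (hsurj n)
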